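/- Let $X$ be a nonempty set and let $\mathcal A$ be an algebra (not necessarily containing the constants) of bounded real-valued functions on $X$ that is uniformly closed, separates the points of $X$, and is countably generated, i.e. there is a sequence in $\mathcal A$ such that $\mathcal A$ is the smallest uniformly closed algebra containing it. Let $\mathcal E:\mathcal A\to[0,+\infty]$ be a quadratic form, i.e. $\mathcal E(cf)=c^2\mathcal E(f)$ for $c\in\mathbb R$ (with $0\cdot\infty=0$) and $\mathcal E(f+g)+\mathcal E(f-g)=2\mathcal E(f)+2\mathcal E(g)$ for all $f,g\in\mathcal A$. Suppose that * $\mathcal E$ is sup-norm-separable: there is a sequence $(f_n)\subset\mathcal A$ generating $\mathcal A$ (as above) with $\mathcal E(f_n)<\infty$ for all $n$; * $\mathcal E$ is $\sigma$-finite: there is $\chi\in\mathcal A$ with $\chi(x)>0$ for all $x\in X$ and $\mathcal E(\chi)<\infty$; * $\mathcal E$ is sup-norm-lower semicontinuous: $\mathcal E(f)\le\liminf_n\mathcal E(f_n)$ whenever $f_n,f\in\mathcal A$ and $f_n\to f$ uniformly; * normal contractions operate on $\mathcal E$: $\mathcal E(F(f_1,\dots,f_k))^{1/2}\le\sum_{i=1}^k\mathcal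 E(f_i)^{1/2}$ for all $k$, all $f_1,\dots,f_k\in\mathcal A$ and all $F:\mathbb R^k\to\mathbb R$ with $F(0)=0$ and $|F(x)-F(y)|\le\sum_{i=1}^k|x_i-y_i|$ for all $x,y\in\mathbb R^k$. Let $\mathcal D=\{f\in\mathcal A:\mathcal E(f)<\infty\}$ and $\mathcal E(f,g)=\frac14(\mathcal E(f+g)-\mathcal E(f-g))$ for $f,g\in\mathcal D$. Let $\Delta$ be the Gelfand spectrum of the complexification $\mathcal A_{\mathbb C}=\mathcal A+i\mathcal A$, that is, the set of nonzero multiplicative linear functionals $\varphi:\mathcal A_{\mathbb C}\to\mathbb C$ with the topology of pointwise convergence, and for $f\in\mathcal A$ let $\hat f(\varphi)=\varphi(f)$, $\varphi\in\Delta$, be its Gelfand transform. Then: 1. $\Delta$ is a locally compact separable metrizable space. 2. $\mathcal D$ is an algebra under pointwise operations. For $f\in\mathcal D$ the function $\hat f$ is real-valued, continuous and vanishes at infinity, and $f\mapsto\hat f$ is an isomorphism of algebras from $\mathcal D$ onto $\hat{\mathcal D}:=\{\hat f:f\in\mathcal D\}$ with $\sup_\Delta|\hat f|=\sup_X|f|$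 for all $f\in\mathcal D$. 3. There is a finite Radon measure $\hat m$ on $\Delta$ with full support and a regular Dirichlet form $(\hat{\mathcal E},\hat{\mathcal F})$ on $L^2(\Delta,\hat m)$ such that $\hat{\mathcal D}\subset\hat{\mathcal F}$, $\hat{\mathcal E}(\hat f,\hat f)=\mathcal E(f)$ and $\hat{\mathcal E}(\hat f,\hat g)=\mathcal E(f,g)$ for all $f,g\in\mathcal D$, and $\hat{\mathcal D}_c:=\{\hat f: f\in\mathcal D,\ \hat f \text{ has compact support}\}$ is a core for $(\hat{\mathcal E},\hat{\mathcal F})$. Here a Dirichlet form on a real $L^2(\Delta,\hat m)$ is a symmetric, nonnegative definite bilinear form $\hat{\mathcal E}$ on a dense subspace $\hat{\mathcal F}$, complete for the norm $(\hat{\mathcal E}(u,u)+\|u\|_{L^2}^2)^{1/2}$, such that $v:=(u\wedge1)\vee0\in\hat{\mathcal F}$ and $\hat{\mathcal E}(v,v)\le\hat{\mathcal E}(u,u)$ for all $u\in\hat{\mathcal F}$. A core is a subset of $\hat{\mathcal F}\cap C_c(\Delta)$ that is dense in $\hat{\mathcal F}$ for this norm and uniformly dense in $C_c(\Delta)$;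 the form is regular if it has a core. -/

import Mathlib

open Filter Topology MeasureTheory
open scoped ENNReal BoundedContinuousFunction ZeroAtInfty CompactlySupported

noncomputable section

namespace SupNormForm

/-! ### Algebras of bounded functions

A set `X` is regarded as a discrete topological space, so that `X →ᵇ ℝ` and `X →ᵇ ℂ` are the algebras
of all bounded functions on `X` with the supremum norm. Algebras need not contain the constants. -/

section Algebra

variable {X : Type*} [TopologicalSpace X] [DiscreteTopology X]

/-- The functions in `S` generate `A` as a uniformly closed algebra. -/
def Generates {A : NonUnitalSubalgebra ℝ (X →ᵇ ℝ)} (S : Set A) : Prop :=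
  Dense (NonUnitalAlgebra.adjoin ℝ S : Set A)

/-- `A` is generated, as a uniformly closed algebra, by a sequence of its members. -/
def CountablyGenerated (A : NonUnitalSubalgebra ℝ (X →ᵇ ℝ)) : Prop :=
  ∃ f : ℕ → A, Generates (Set.range f)

/-- `A` separates the points of `X`. -/
def SeparatesPoints (A : NonUnitalSubalgebra ℝ (X →ᵇ ℝ)) : Prop :=
  ∀ x y : X, x ≠ y → ∃ f ∈ A, f x ≠ f y

/-- The natural complexification `A + iA` of an algebra `A` of bounded real functions. -/
def complexification (A : NonUnitalSubalgebra ℝ (X →ᵇ ℝ)) :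
    NonUnitalStarSubalgebra ℂ (X →ᵇ ℂ) where
  carrier := {f | ∃ u ∈ A, ∃ v ∈ A, ∀ x, f x = (u x : ℂ) + (v x : ℂ) * Complex.I}
  add_mem' := by
    rintro f g ⟨u, hu, v, hv, h⟩ ⟨u', hu', v', hv', h'⟩
    refine ⟨u + u', A.add_mem hu hu', v + v', A.add_mem hv hv', fun x => ?_⟩
    simp only [BoundedContinuousFunction.coe_add, Pi.add_apply, h x, h' x, Complex.ofReal_add]
    ring
  zero_mem' := ⟨0, A.zero_mem, 0, A.zero_mem, fun x => by simp⟩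
  mul_mem' := by
    rintro f g ⟨u, hu, v, hv, h⟩ ⟨u', hu', v', hv', h'⟩
    refine ⟨u * u' - v * v', A.sub_mem (A.mul_mem hu hu') (A.mul_mem hv hv'),
      u * v' + v * u', A.add_mem (A.mul_mem hu hv') (A.mul_mem hv hu'), fun x => ?_⟩
    simp only [BoundedContinuousFunction.coe_add, BoundedContinuousFunction.coe_sub,
      BoundedContinuousFunction.coe_mul, Pi.add_apply, Pi.sub_apply, Pi.mul_apply, h x, h' x,
      Complex.ofReal_add, Complex.ofReal_sub, Complex.ofReal_mul]
    linear_combination (v x * v' x : ℂ) * Complex.I_mul_I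
  smul_mem' := by
    rintro c f ⟨u, hu, v, hv, h⟩
    refine ⟨c.re • u - c.im • v, A.sub_mem (SMulMemClass.smul_mem _ hu) (SMulMemClass.smul_mem _ hv),
      c.re • v + c.im • u, A.add_mem (SMulMemClass.smul_mem _ hv) (SMulMemClass.smul_mem _ hu), fun x => ?_⟩
    simp only [BoundedContinuousFunction.coe_add, BoundedContinuousFunction.coe_sub,
      BoundedContinuousFunction.coe_smul, Pi.add_apply, Pi.sub_apply, smul_eq_mul, h x,
      Complex.ofReal_add, Complex.ofReal_sub, Complex.ofReal_mul]
    conv_lhs => rw [← Complex.re_add_im c]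
    linear_combination (c.im * v x : ℂ) * Complex.I_mul_I
  star_mem' := by
    rintro f ⟨u, hu, v, hv, h⟩
    refine ⟨u, hu, -v, A.neg_mem hv, fun x => ?_⟩
    simp [BoundedContinuousFunction.star_apply, h x]

/-- A real function `f ∈ A`, seen as an element of the complexification of `A`. -/
def toComplexification {A : NonUnitalSubalgebra ℝ (X →ᵇ ℝ)} (f : A) : complexification A :=
  ⟨BoundedContinuousFunction.comp (fun t : ℝ => (t : ℂ)) Complex.isometry_ofReal.lipschitz
      (f : X →ᵇ ℝ),
    f, f.2, 0, A.zero_mem, fun x => by simp⟩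

/-- The Gelfand spectrum `Δ` of the complexification of `A`: the nonzero multiplicative
linear functionals (continuity is automatic, as `A` will be uniformly closed), with the topology of
pointwise convergence. -/
abbrev Spectrum (A : NonUnitalSubalgebra ℝ (X →ᵇ ℝ)) : Type _ :=
  WeakDual.characterSpace ℂ (complexification A)

/-- The spectrum carries its Borel σ-algebra. -/
instance spectrumMeasurableSpace (A : NonUnitalSubalgebra ℝ (X →ᵇ ℝ)) :
    MeasurableSpace (Spectrum A) := borel _

instance spectrumBorelSpace (A : NonUnitalSubalgebra ℝ (X →ᵇ ℝ)) : BorelSpace (Spectrum A) := ⟨rfl⟩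

/-- The Gelfand transform `φ ↦ φ(f)` of `f ∈ A`. -/
def gelfand {A : NonUnitalSubalgebra ℝ (X →ᵇ ℝ)} (f : A) (φ : Spectrum A) : ℂ :=
  φ (toComplexification f)

end Algebra

/-! ### Extended real valued quadratic forms -/

/-- `E : V → [0,∞]` is a quadratic form (with `0 * ∞ = 0`, so that `E 0 = 0`). -/
structure IsQuadraticForm {V : Type*} [AddCommGroup V] [Module ℝ V] (E : V → ℝ≥0∞) : Prop where
  map_smul : ∀ (c : ℝ) (f : V), E (c • f) = ENNReal.ofReal (c ^ 2) * E f
  parallelogram : ∀ f g : V, E (f + g) + E (f - g) = 2 * E f + 2 * E g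

/-- The real valued form obtained from `E` by polarization; meaningful where `E` is finite. -/
def polarization {V : Type*} [AddCommGroup V] (E : V → ℝ≥0∞) (f g : V) : ℝ :=
  ((E (f + g)).toReal - (E (f - g)).toReal) / 4

/-- A normal contraction in `k` variables. -/
def IsNormalContraction {k : ℕ} (F : (Fin k → ℝ) → ℝ) : Prop :=
  F 0 = 0 ∧ ∀ x y : Fin k → ℝ, |F x - F y| ≤ ∑ i, |x i - y i|

section Form

variable {X : Type*} [TopologicalSpace X] [DiscreteTopology X] {A : NonUnitalSubalgebra ℝ (X →ᵇ ℝ)}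

/-- `A` is generated by a sequence of functions of finite energy. -/
def SupNormSeparable (E : A → ℝ≥0∞) : Prop :=
  ∃ f : ℕ → A, Generates (Set.range f) ∧ ∀ n, E (f n) < ∞

/-- `A` contains a strictly positive function of finite energy. -/
def SigmaFiniteForm (E : A → ℝ≥0∞) : Prop :=
  ∃ χ : A, (∀ x, 0 < (χ : X →ᵇ ℝ) x) ∧ E χ < ∞

/-- Lower semicontinuity along uniformly convergent sequences. -/
def SupNormLSC (E : A → ℝ≥0∞) : Prop :=
  ∀ (f : ℕ → A) (g : A), Tendsto f atTop (𝓝 g) → E g ≤ liminf (fun n => E (f n)) atTop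

/-- Normal contractions operate on `E`; here `g` is the function `F(f₁,…,f_k)`. -/
def NormalContractionsOperate (E : A → ℝ≥0∞) : Prop :=
  ∀ (k : ℕ) (F : (Fin k → ℝ) → ℝ), IsNormalContraction F → ∀ (f : Fin k → A) (g : A),
    (∀ x, (g : X →ᵇ ℝ) x = F (fun i => (f i : X →ᵇ ℝ) x)) →
      E g ^ (1 / 2 : ℝ) ≤ ∑ i, E (f i) ^ (1 / 2 : ℝ)

end Form

/-! ### Dirichlet forms -/

/-- A (symmetric) Dirichlet form on `L²(Y, μ)`. -/
structure DirichletForm {Y : Type*} [MeasurableSpace Y] (μ : Measure Y) where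
  /-- the domain -/
  domain : Submodule ℝ (Lp ℝ 2 μ)
  /-- the bilinear form -/
  form : domain →ₗ[ℝ] domain →ₗ[ℝ] ℝ
  dense_domain : Dense (domain : Set (Lp ℝ 2 μ))
  symm : ∀ u v, form u v = form v u
  nonneg : ∀ u, 0 ≤ form u u
  /-- the domain is complete for the norm `(form u u + ‖u‖²)^(1/2)` -/
  complete : ∀ u : ℕ → domain,
    (∀ ε : ℝ, 0 < ε → ∃ N, ∀ m ≥ N, ∀ n ≥ N,
      form (u m - u n) (u m - u n) + ‖u m - u n‖ ^ 2 < ε) →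
    ∃ v : domain, Tendsto (fun n => form (u n - v) (u n - v) + ‖u n - v‖ ^ 2) atTop (𝓝 0)
  /-- the Markov property: `(u ∧ 1) ∨ 0` lies in the domain and has no more energy than `u` -/
  markov : ∀ u : domain, ∃ v : domain,
    ((v : Lp ℝ 2 μ) : Y → ℝ) =ᵐ[μ] (fun y => max (min (((u : Lp ℝ 2 μ) : Y → ℝ) y) 1) 0) ∧
      form v v ≤ form u u

namespace DirichletForm

variable {Y : Type*} [MeasurableSpace Y] {μ : Measure Y}

/-- The element `u` of the domain is the `μ`-class of the function `h`. -/
def IsClassOf {𝓔 : DirichletForm μ} (u : 𝓔.domain) (h : Y → ℝ) : Prop :=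
  ((u : Lp ℝ 2 μ) : Y → ℝ) =ᵐ[μ] h

/-- `C` is a core: it is contained in the domain, dense there for the Hilbert norm
`(form u u + ‖u‖²)^(1/2)`, and uniformly dense in the continuous functions with compact support. -/
structure IsCore [TopologicalSpace Y] (𝓔 : DirichletForm μ) (C : Set C_c(Y, ℝ)) : Prop where
  subset_domain : ∀ h ∈ C, ∃ u : 𝓔.domain, IsClassOf u h
  dense_domain : ∀ u : 𝓔.domain, ∀ ε : ℝ, 0 < ε → ∃ h ∈ C, ∃ v : 𝓔.domain,
    IsClassOf v h ∧ 𝓔.form (u - v) (u - v) + ‖u - v‖ ^ 2 < ε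
  dense_sup : ∀ h : C_c(Y, ℝ), ∀ ε : ℝ, 0 < ε → ∃ g ∈ C, ∀ y, |h y - g y| < ε

/-- A regular Dirichlet form: on a locally compact separable metrizable space with a Radon measure
of full support, and with a core. -/
structure IsRegular [TopologicalSpace Y] [BorelSpace Y] (𝓔 : DirichletForm μ) : Prop where
  locallyCompact : LocallyCompactSpace Y
  separable : TopologicalSpace.SeparableSpace Y
  metrizable : TopologicalSpace.MetrizableSpace Y
  radon : μ.Regular
  fullSupport : μ.IsOpenPosMeasure
  exists_core : ∃ C : Set C_c(Y, ℝ), 𝓔.IsCore C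

end DirichletForm

end SupNormForm

end

/-!
A lower semicontinuous quadratic form on a separable algebra of bounded functions becomes a regular
Dirichlet form on the Gelfand spectrum of the algebra.

Transport to `C₀`. Characters of the complexification of `A` are contractive and real on real
functions, so that the Gelfand transform `gelfandHom` maps `A` isometrically (test on the
evaluations `evalCharacter`) into `C₀(Spectrum A, ℝ)`; by Stone–Weierstrass and completeness it is
onto. The characters and the zero functional form a weak-* compact set, metrizable by separability
of `A`, and the spectrum is open in it. It remains to treat a lower semicontinuous form `q` with
dense domain on `C₀(Y, ℝ)`, on which contractions operate (`exists_dirichletForm_isCore`).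

The reference measure. The unit ball `{q ≤ 1}` is convex, as the contraction `(s, t) ↦ s + t` makes
`√q` subadditive, and closed by lower semicontinuity. By Hahn–Banach and the Lindelöf property `√q`
is a supremum of countably many `|l n|` with continuous linear `l n` (`exists_seq_functional`). Each
`l n` is dominated by the integral against a finite measure, its total variation
(`exists_measure_abs_le_integral`), and a suitable weighted sum of these measures and of Dirac
masses at a dense sequence is a finite measure `m` of full support such that every `l n` is bounded
for the norm of `L²(m)` (`exists_measure_forall_abs_le`). A sequence that is Cauchy in energy and
tends to zero in `L²(m)` therefore has energies tending to zero: the form is closable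
(`tendsto_of_cauchy_of_tendsto_functional`).

The closure. The form domain is the completion of the functions of finite energy, mapped injectively
into `L²(m)` by closability (`exists_closure_of_closable`). Weak compactness of balls in this
Hilbert space carries the contraction property over to the closure.

The core. Soft thresholding `f ↦ f - ((f ∧ ε) ∨ (-ε))` is a normal contraction and yields compactly
supported functions that tend to `f` uniformly as `ε → 0`. Their energies do not exceed that of
`f`, so that lower semicontinuity and the parallelogram law give convergence in energy
(`IsQuadraticForm.tendsto_toReal_sub`).
-/

noncomputable section

namespace SupNormForm

/-! ### The Stone–Weierstrass theorem on locally compact spaces -/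

section StoneWeierstrass

variable {Y : Type*} [TopologicalSpace Y] [R1Space Y]

/-- The extension of a function vanishing at infinity by zero to the one-point compactification. -/
def onePointExtend (h : C₀(Y, ℝ)) : C(OnePoint Y, ℝ) where
  toFun z := z.elim 0 h
  continuous_toFun := by
    rw [OnePoint.continuous_iff]
    rw [coclosedCompact_eq_cocompact]
    exact ⟨h.zero_at_infty', h.continuous⟩

@[simp] lemma onePointExtend_coe (h : C₀(Y, ℝ)) (y : Y) : onePointExtend h (y : OnePoint Y) = h y :=
  rfl

@[simp] lemma onePointExtend_infty (h : C₀(Y, ℝ)) : onePointExtend h OnePoint.infty = 0 := rfl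

/-- The unital subalgebra of `C(OnePoint Y, ℝ)` spanned by the constants and the extensions of the
members of a subalgebra of `C₀(Y, ℝ)`. -/
def onePointSubalgebra (S : NonUnitalSubalgebra ℝ C₀(Y, ℝ)) : Subalgebra ℝ C(OnePoint Y, ℝ) where
  carrier := {g | ∃ f ∈ S, ∀ y : Y, g y = f y + g OnePoint.infty}
  mul_mem' := by
    rintro g g' ⟨f, hf, h⟩ ⟨f', hf', h'⟩
    refine ⟨f * f' + g' OnePoint.infty • f + g OnePoint.infty • f', S.add_mem (S.add_mem
      (S.mul_mem hf hf') (SMulMemClass.smul_mem _ hf)) (SMulMemClass.smul_mem _ hf'), fun y => ?_⟩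
    simp [h y, h' y]
    ring
  add_mem' := by
    rintro g g' ⟨f, hf, h⟩ ⟨f', hf', h'⟩
    refine ⟨f + f', S.add_mem hf hf', fun y => ?_⟩
    simp [h y, h' y]
    ring
  algebraMap_mem' r := ⟨0, S.zero_mem, fun y => by simp⟩

/-- **Stone–Weierstrass** for functions vanishing at infinity: a subalgebra that separates the
points and vanishes nowhere is dense. -/
theorem dense_of_separatesPoints_of_exists_ne_zero (S : NonUnitalSubalgebra ℝ C₀(Y, ℝ))
    (hsep : ∀ x y : Y, x ≠ y → ∃ f ∈ S, f x ≠ f y) (hne : ∀ x : Y, ∃ f ∈ S, f x ≠ 0) :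
    Dense (S : Set C₀(Y, ℝ)) := by
  have hmem : ∀ f ∈ S, onePointExtend f ∈ onePointSubalgebra S := fun f hf =>
    ⟨f, hf, fun y => by simp⟩
  have key : (onePointSubalgebra S).SeparatesPoints := by
    intro x y hxy
    induction x using OnePoint.rec with
    | infty =>
      induction y using OnePoint.rec with
      | infty => exact absurd rfl hxy
      | coe y =>
        obtain ⟨f, hf, hfy⟩ := hne y
        exact ⟨_, ⟨_, hmem f hf, rfl⟩, by simpa using hfy.symm⟩
    | coe x =>
      induction y using OnePoint.rec with
      | infty =>
        obtain ⟨f, hf, hfy⟩ := hne x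
        exact ⟨_, ⟨_, hmem f hf, rfl⟩, by simpa using hfy⟩
      | coe y =>
        obtain ⟨f, hf, hfy⟩ := hsep x y (fun h => hxy (by rw [h]))
        exact ⟨_, ⟨_, hmem f hf, rfl⟩, by simpa using hfy⟩
  rw [Metric.dense_iff]
  intro h ε hε
  obtain ⟨⟨g, f, hf, hg⟩, hgh⟩ :=
    ContinuousMap.exists_mem_subalgebra_near_continuousMap_of_separatesPoints _ key
      (onePointExtend h) (ε / 4) (by positivity)
  refine ⟨f, ?_, hf⟩
  rw [Metric.mem_ball, ← ZeroAtInftyContinuousMap.dist_toBCF_eq_dist]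
  refine lt_of_le_of_lt ((BoundedContinuousFunction.dist_le (C := ε / 2) (by positivity)).2
    fun y => ?_) (by linarith)
  have h1 := (ContinuousMap.norm_coe_le_norm (g - onePointExtend h) (y : OnePoint Y)).trans hgh.le
  have h2 := (ContinuousMap.norm_coe_le_norm (g - onePointExtend h) OnePoint.infty).trans hgh.le
  simp only [ContinuousMap.sub_apply, onePointExtend_coe, onePointExtend_infty, hg y,
    Real.norm_eq_abs, abs_le, sub_zero] at h1 h2
  change |f y - h y| ≤ _
  rw [abs_le]
  constructor <;> linarith [h1.1, h1.2, h2.1, h2.2]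

end StoneWeierstrass

/-! ### The Gelfand transform of an algebra of bounded functions -/

section Gelfand

lemma le_of_forall_pow_mul_le {a C x K : ℝ} (ha : 0 < a) (hK : 0 ≤ K)
    (h : ∀ n : ℕ, x ^ n * a ≤ C * K ^ n) : x ≤ K := by
  by_contra! hx
  have hx0 : 0 < x := hK.trans_lt hx
  have hlim : Tendsto (fun n : ℕ => C * (K / x) ^ n) atTop (𝓝 (C * 0)) :=
    (tendsto_pow_atTop_nhds_zero_of_lt_one (by positivity) ((div_lt_one hx0).2 hx)).const_mul C
  rw [mul_zero] at hlim
  refine absurd (ge_of_tendsto' hlim fun n => ?_) (not_le.2 ha)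
  rw [div_pow, ← mul_div_assoc, le_div_iff₀ (by positivity), mul_comm a]
  exact h n

variable {X : Type*} [TopologicalSpace X]

/-- A character of an algebra of bounded functions extends to a contraction on the algebra with the
constants adjoined: this bounds `φ(u) + c` by the supremum of `u + c`. -/
lemma norm_character_add_le {B : NonUnitalStarSubalgebra ℂ (X →ᵇ ℂ)}
    (φ : WeakDual.characterSpace ℂ B) (u : B) (c : ℂ) {K : ℝ} (hK : 0 ≤ K)
    (hu : ∀ x, ‖(u : X →ᵇ ℂ) x + c‖ ≤ K) : ‖φ u + c‖ ≤ K := by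
  obtain ⟨h, hh⟩ : ∃ h : B, φ h ≠ 0 := by
    by_contra! hcon
    exact φ.2.1 (ContinuousLinearMap.ext hcon)
  -- in `B` only `(u + c)ⁿ h` makes sense; the constant `‖φ‖ ‖h‖` is lost by taking `n`-th roots
  have key : ∀ n : ℕ, ∃ w : B, φ w = (φ u + c) ^ n * φ h ∧ ‖w‖ ≤ K ^ n * ‖h‖ := by
    intro n
    induction n with
    | zero => exact ⟨h, by simp, by simp⟩
    | succ n ih =>
      obtain ⟨w, hw, hwn⟩ := ih
      refine ⟨u * w + c • w, ?_, ?_⟩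
      · rw [map_add, map_mul, map_smul, hw, smul_eq_mul]
        ring
      · refine (BoundedContinuousFunction.norm_le (by positivity)).2 fun x => ?_
        have : ((u * w + c • w : B) : X →ᵇ ℂ) x
            = ((u : X →ᵇ ℂ) x + c) * (w : X →ᵇ ℂ) x := by
          simp [add_mul]
        change ‖((u * w + c • w : B) : X →ᵇ ℂ) x‖ ≤ _
        rw [this, norm_mul, pow_succ', mul_assoc]
        exact mul_le_mul (hu x) (((w : X →ᵇ ℂ).norm_coe_le_norm x).trans hwn) (norm_nonneg _) hK
  refine le_of_forall_pow_mul_le (a := ‖φ h‖)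
    (C := ‖WeakDual.toStrongDual (φ : WeakDual ℂ B)‖ * ‖h‖) (norm_pos_iff.2 hh) hK fun n => ?_
  obtain ⟨w, hw, hwn⟩ := key n
  calc ‖φ u + c‖ ^ n * ‖φ h‖ = ‖φ w‖ := by rw [hw, norm_mul, norm_pow]
    _ ≤ ‖WeakDual.toStrongDual (φ : WeakDual ℂ B)‖ * ‖w‖ :=
      (WeakDual.toStrongDual (φ : WeakDual ℂ B)).le_opNorm w
    _ ≤ ‖WeakDual.toStrongDual (φ : WeakDual ℂ B)‖ * (K ^ n * ‖h‖) := by gcongr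
    _ = _ := by ring

lemma norm_character_le {B : NonUnitalStarSubalgebra ℂ (X →ᵇ ℂ)}
    (φ : WeakDual.characterSpace ℂ B) (u : B) : ‖φ u‖ ≤ ‖u‖ := by
  simpa using norm_character_add_le φ u 0 (norm_nonneg u)
    fun x => by simpa using (u : X →ᵇ ℂ).norm_coe_le_norm x

variable {A : NonUnitalSubalgebra ℝ (X →ᵇ ℝ)}

@[simp] lemma toComplexification_apply (f : A) (x : X) :
    (toComplexification f : X →ᵇ ℂ) x = ((f : X →ᵇ ℝ) x : ℂ) := rfl

lemma toComplexification_add (f g : A) :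
    toComplexification (f + g) = toComplexification f + toComplexification g :=
  Subtype.ext <| BoundedContinuousFunction.ext fun x => by simp

lemma toComplexification_mul (f g : A) :
    toComplexification (f * g) = toComplexification f * toComplexification g :=
  Subtype.ext <| BoundedContinuousFunction.ext fun x => by simp

lemma toComplexification_smul (c : ℝ) (f : A) :
    toComplexification (c • f) = (c : ℂ) • toComplexification f :=
  Subtype.ext <| BoundedContinuousFunction.ext fun x => by simp

lemma norm_toComplexification (f : A) : ‖toComplexification f‖ = ‖(f : X →ᵇ ℝ)‖ := by
  change ‖(toComplexification f : X →ᵇ ℂ)‖ = ‖(f : X →ᵇ ℝ)‖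
  refine le_antisymm ((BoundedContinuousFunction.norm_le (norm_nonneg _)).2 fun x => ?_)
    ((BoundedContinuousFunction.norm_le (norm_nonneg _)).2 fun x => ?_)
  · simpa using (f : X →ᵇ ℝ).norm_coe_le_norm x
  · simpa using (toComplexification f : X →ᵇ ℂ).norm_coe_le_norm x

lemma exists_eq_toComplexification_add (w : complexification A) :
    ∃ u v : A, w = toComplexification u + Complex.I • toComplexification v := by
  obtain ⟨u, hu, v, hv, h⟩ := w.2
  refine ⟨⟨u, hu⟩, ⟨v, hv⟩, Subtype.ext <| BoundedContinuousFunction.ext fun x => ?_⟩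
  simp [h x, mul_comm]

/-- Characters are real on real functions. For `φ(f) = a + ib` and all real `t`, Arens' estimate
`a² + (b + t)² ≤ ‖f‖² + t²` forces `b = 0`. -/
lemma gelfand_im (f : A) (φ : Spectrum A) : (gelfand f φ).im = 0 := by
  set z := gelfand f φ with hz
  have key : ∀ t : ℝ, z.re ^ 2 + (z.im + t) ^ 2 ≤ ‖(f : X →ᵇ ℝ)‖ ^ 2 + t ^ 2 := by
    intro t
    have h := norm_character_add_le φ (toComplexification f) (t * Complex.I)
      (K := √(‖(f : X →ᵇ ℝ)‖ ^ 2 + t ^ 2)) (Real.sqrt_nonneg _) fun x => by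
        rw [toComplexification_apply, Complex.norm_add_mul_I]
        apply Real.sqrt_le_sqrt
        have := sq_le_sq' (neg_le_of_abs_le ((f : X →ᵇ ℝ).norm_coe_le_norm x))
          (le_of_abs_le ((f : X →ᵇ ℝ).norm_coe_le_norm x))
        exact add_le_add this le_rfl
    rw [Real.le_sqrt (norm_nonneg _) (by positivity), Complex.sq_norm, Complex.normSq_apply] at h
    change (z + t * Complex.I).re * (z + t * Complex.I).re
      + (z + t * Complex.I).im * (z + t * Complex.I).im ≤ _ at h
    simp at h
    nlinarith
  by_contra hb
  -- at this `t` the linear term of `(b + t)²` exceeds `‖f‖²`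
  have h := key ((‖(f : X →ᵇ ℝ)‖ ^ 2 + 1) / (2 * z.im))
  have h2 : 2 * z.im * ((‖(f : X →ᵇ ℝ)‖ ^ 2 + 1) / (2 * z.im)) =
      ‖(f : X →ᵇ ℝ)‖ ^ 2 + 1 := by field_simp
  nlinarith [sq_nonneg z.re, sq_nonneg z.im]

lemma continuous_gelfand (f : A) : Continuous (gelfand f) :=
  (WeakDual.eval_continuous (toComplexification f)).comp continuous_subtype_val

variable (A) in
/-- The characters together with the zero functional. -/
abbrev SpectrumZero : Set (WeakDual ℂ (complexification A)) :=
  WeakDual.characterSpace ℂ (complexification A) ∪ {0}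

variable (A) in
lemma isCompact_spectrumZero : IsCompact (SpectrumZero A) := by
  refine (WeakDual.isCompact_closedBall 0 1).of_isClosed_subset
    (WeakDual.CharacterSpace.union_zero_isClosed ℂ (complexification A)) ?_
  rintro φ (hφ | rfl)
  · rw [Set.mem_preimage, mem_closedBall_zero_iff]
    refine ContinuousLinearMap.opNorm_le_bound _ zero_le_one fun u => ?_
    rw [one_mul]
    exact norm_character_le ⟨φ, hφ⟩ u
  · simp

variable (A) in
lemma isOpenEmbedding_spectrum :
    IsOpenEmbedding (Set.inclusion Set.subset_union_left : Spectrum A → SpectrumZero A) := by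
  refine ⟨IsEmbedding.inclusion _, ?_⟩
  have : Set.range (Set.inclusion Set.subset_union_left : Spectrum A → SpectrumZero A)
      = {z : SpectrumZero A | (z : WeakDual ℂ (complexification A)) ≠ 0} := by
    ext z
    constructor
    · rintro ⟨φ, rfl⟩
      exact φ.2.1
    · intro hz
      exact ⟨⟨z, z.2.resolve_right hz⟩, rfl⟩
  rw [this]
  exact isOpen_ne.preimage continuous_subtype_val

instance : LocallyCompactSpace (Spectrum A) :=
  have := isCompact_iff_compactSpace.1 (isCompact_spectrumZero A)
  (isOpenEmbedding_spectrum A).locallyCompactSpace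

lemma metrizableSpace_spectrumZero [TopologicalSpace.SeparableSpace (complexification A)] :
    TopologicalSpace.MetrizableSpace (SpectrumZero A) :=
  WeakDual.metrizable_of_isCompact ℂ _ _ (isCompact_spectrumZero A)

lemma metrizableSpace_spectrum [TopologicalSpace.SeparableSpace (complexification A)] :
    TopologicalSpace.MetrizableSpace (Spectrum A) :=
  have := metrizableSpace_spectrumZero (A := A)
  (isOpenEmbedding_spectrum A).isEmbedding.metrizableSpace

lemma secondCountableTopology_spectrum [TopologicalSpace.SeparableSpace (complexification A)] :
    SecondCountableTopology (Spectrum A) := by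
  have := metrizableSpace_spectrumZero (A := A)
  have := isCompact_iff_compactSpace.1 (isCompact_spectrumZero A)
  let := TopologicalSpace.metrizableSpaceMetric (SpectrumZero A)
  have : SecondCountableTopology (SpectrumZero A) := inferInstance
  exact (isOpenEmbedding_spectrum A).isEmbedding.secondCountableTopology

lemma tendsto_gelfand_cocompact (f : A) : Tendsto (gelfand f) (cocompact (Spectrum A)) (𝓝 0) := by
  rw [Metric.tendsto_nhds]
  intro ε hε
  refine Filter.mem_cocompact.2 ?_
  refine ⟨{φ | ε ≤ ‖gelfand f φ‖}, ?_, fun φ hφ => by simpa using hφ⟩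
  have := isCompact_iff_compactSpace.1 (isCompact_spectrumZero A)
  rw [(isOpenEmbedding_spectrum A).isEmbedding.isCompact_iff]
  have hcont : Continuous fun z : SpectrumZero A =>
      ‖(z : WeakDual ℂ (complexification A)) (toComplexification f)‖ :=
    ((WeakDual.eval_continuous _).comp continuous_subtype_val).norm
  refine IsClosed.isCompact ?_
  convert isClosed_le (continuous_const (y := ε)) hcont using 1
  ext z
  constructor
  · rintro ⟨φ, hφ, rfl⟩
    exact hφ
  · intro hz
    have h0 : (z : WeakDual ℂ (complexification A)) ≠ 0 := by
      intro h0
      have : ε ≤ ‖(z : WeakDual ℂ (complexification A)) (toComplexification f)‖ := hz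
      rw [h0] at this
      simp only [show (0 : WeakDual ℂ (complexification A)) (toComplexification f) = 0 from rfl,
        norm_zero] at this
      linarith
    exact ⟨⟨z, z.2.resolve_right h0⟩, hz, rfl⟩

/-- The Gelfand transform on `A`, with values in the real functions vanishing at infinity. -/
def gelfandHom (A : NonUnitalSubalgebra ℝ (X →ᵇ ℝ)) : A →ₙₐ[ℝ] C₀(Spectrum A, ℝ) where
  toFun f :=
    { toFun := fun φ => (gelfand f φ).re
      continuous_toFun := Complex.continuous_re.comp (continuous_gelfand f)
      zero_at_infty' := by
        exact (Complex.continuous_re.tendsto 0).comp (tendsto_gelfand_cocompact f) }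
  map_smul' c f := by
    ext φ
    change (φ (toComplexification (c • f))).re = c * (φ (toComplexification f)).re
    rw [toComplexification_smul, map_smul, smul_eq_mul, Complex.re_ofReal_mul]
  map_zero' := by
    ext φ
    have : toComplexification (0 : A) = 0 :=
      Subtype.ext <| BoundedContinuousFunction.ext fun x => by simp
    simp [gelfand, this]
  map_add' f g := by
    ext φ
    simp [gelfand, toComplexification_add]
  map_mul' f g := by
    ext φ
    have h1 := gelfand_im f φ
    have h2 := gelfand_im g φ
    simp only [gelfand] at h1 h2
    simp [gelfand, toComplexification_mul, h1, h2]

lemma coe_gelfandHom_apply (f : A) (φ : Spectrum A) : ((gelfandHom A f φ : ℝ) : ℂ) = gelfand f φ :=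
  Complex.ext rfl (gelfand_im f φ).symm

/-- Evaluation at a point where the algebra does not vanish, as a character. -/
def evalCharacter (x : X) (hx : ∃ f : A, (f : X →ᵇ ℝ) x ≠ 0) : Spectrum A :=
  ⟨(BoundedContinuousFunction.evalCLM ℂ x).comp
      (complexification A).toNonUnitalSubalgebra.toSubmodule.subtypeL, by
    obtain ⟨f, hf⟩ := hx
    refine ⟨fun h => hf ?_, fun u v => rfl⟩
    have := DFunLike.congr_fun h (toComplexification f)
    exact Complex.ofReal_injective this⟩

lemma gelfandHom_evalCharacter (f : A) (x : X) (hx : ∃ f : A, (f : X →ᵇ ℝ) x ≠ 0) :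
    gelfandHom A f (evalCharacter x hx) = (f : X →ᵇ ℝ) x := rfl

lemma norm_gelfandHom (hA : ∀ x, ∃ f : A, (f : X →ᵇ ℝ) x ≠ 0) (f : A) :
    ‖gelfandHom A f‖ = ‖(f : X →ᵇ ℝ)‖ := by
  rw [← ZeroAtInftyContinuousMap.norm_toBCF_eq_norm]
  refine le_antisymm ((BoundedContinuousFunction.norm_le (norm_nonneg _)).2 fun φ => ?_)
    ((BoundedContinuousFunction.norm_le (norm_nonneg _)).2 fun x => ?_)
  · rw [← norm_toComplexification f]
    exact (Complex.abs_re_le_norm _).trans (norm_character_le φ _)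
  · rw [← gelfandHom_evalCharacter f x (hA x)]
    exact (gelfandHom A f).toBCF.norm_coe_le_norm _

lemma dense_range_gelfandHom :
    Dense (NonUnitalAlgHom.range (gelfandHom A) : Set C₀(Spectrum A, ℝ)) := by
  have hdist : ∀ φ ψ : WeakDual ℂ (complexification A),
      (∀ f : A, φ (toComplexification f) = ψ (toComplexification f)) → φ = ψ := by
    intro φ ψ h
    refine DFunLike.ext _ _ fun w => ?_
    obtain ⟨u, v, rfl⟩ := exists_eq_toComplexification_add w
    simp [h]
  refine dense_of_separatesPoints_of_exists_ne_zero _ (fun φ ψ hne => ?_) fun φ => ?_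
  · by_contra! hcon
    refine hne (Subtype.ext (hdist _ _ fun f => ?_))
    have h := hcon (gelfandHom A f) ⟨f, rfl⟩
    change gelfand f φ = gelfand f ψ
    rw [← coe_gelfandHom_apply, ← coe_gelfandHom_apply, h]
  · by_contra! hcon
    refine φ.2.1 (hdist _ _ fun f => ?_)
    have h := hcon (gelfandHom A f) ⟨f, rfl⟩
    change gelfand f φ = 0
    rw [← coe_gelfandHom_apply, h, Complex.ofReal_zero]

lemma isometry_gelfandHom (hA : ∀ x, ∃ f : A, (f : X →ᵇ ℝ) x ≠ 0) : Isometry (gelfandHom A) := by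
  refine Isometry.of_dist_eq fun f g => ?_
  rw [dist_eq_norm, ← map_sub, norm_gelfandHom hA, Subtype.dist_eq, dist_eq_norm]
  rfl

lemma surjective_gelfandHom (hclosed : IsClosed (A : Set (X →ᵇ ℝ)))
    (hA : ∀ x, ∃ f : A, (f : X →ᵇ ℝ) x ≠ 0) : Function.Surjective (gelfandHom A) := by
  have : CompleteSpace A := hclosed.completeSpace_coe
  have hr : IsClosed (Set.range (gelfandHom A)) :=
    (isometry_gelfandHom hA).isClosedEmbedding.isClosed_range
  have hd : Dense (Set.range (gelfandHom A)) := dense_range_gelfandHom (A := A)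
  exact Set.range_eq_univ.1 (hr.closure_eq.symm.trans hd.closure_eq)

/-- The Gelfand isomorphism for a uniformly closed algebra that vanishes nowhere. -/
def gelfandEquiv (hclosed : IsClosed (A : Set (X →ᵇ ℝ)))
    (hA : ∀ x, ∃ f : A, (f : X →ᵇ ℝ) x ≠ 0) : A ≃ₗ[ℝ] C₀(Spectrum A, ℝ) :=
  LinearEquiv.ofBijective (gelfandHom A : A →ₗ[ℝ] C₀(Spectrum A, ℝ))
    ⟨(isometry_gelfandHom hA).injective, surjective_gelfandHom hclosed hA⟩

end Gelfand

/-! ### Separability -/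

section Separability

lemma isSeparable_adjoin {R : Type*} [NonUnitalRing R] [Module ℝ R] [IsScalarTower ℝ R R]
    [SMulCommClass ℝ R R] [TopologicalSpace R] [ContinuousAdd R] [ContinuousSMul ℝ R] {s : Set R}
    (hs : s.Countable) :
    TopologicalSpace.IsSeparable (NonUnitalAlgebra.adjoin ℝ s : Set R) := by
  have hc : (Subsemigroup.closure s : Set R).Countable := by
    have := hs.to_subtype
    have hsub : (Subsemigroup.closure s : Set R)
        ⊆ Set.range (fun w : FreeSemigroup s => FreeSemigroup.lift (fun x : s => (x : R)) w) := by
      intro x hx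
      induction hx using Subsemigroup.closure_induction with
      | mem x hx => exact ⟨FreeSemigroup.of ⟨x, hx⟩, by simp⟩
      | mul x y _ _ hx hy =>
        obtain ⟨a, rfl⟩ := hx
        obtain ⟨b, rfl⟩ := hy
        exact ⟨a * b, by simp⟩
    have : Countable (FreeSemigroup s) :=
      Function.Injective.countable (f := fun w : FreeSemigroup s => (w.head, w.tail))
        fun a b h => by
          cases a; cases b; simpa using h
    exact (Set.countable_range _).mono hsub
  have := hc.isSeparable.span (R := ℝ)
  rwa [← NonUnitalAlgebra.adjoin_eq_span] at this

variable {X : Type*} [TopologicalSpace X]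
  {A : NonUnitalSubalgebra ℝ (X →ᵇ ℝ)}

lemma CountablyGenerated.separableSpace (h : CountablyGenerated A) :
    TopologicalSpace.SeparableSpace A := by
  obtain ⟨f, hf⟩ := h
  have := (isSeparable_adjoin (Set.countable_range f)).closure
  rw [Dense.closure_eq hf] at this
  exact TopologicalSpace.isSeparable_univ_iff.1 this

instance [TopologicalSpace.SeparableSpace A] :
    TopologicalSpace.SeparableSpace (complexification A) := by
  have hiso : Isometry (toComplexification (A := A)) := by
    refine Isometry.of_dist_eq fun f g => ?_
    have : toComplexification (f - g) = toComplexification f - toComplexification g :=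
      Subtype.ext <| BoundedContinuousFunction.ext fun x => by simp
    rw [dist_eq_norm, ← this, norm_toComplexification, Subtype.dist_eq, dist_eq_norm]
    rfl
  refine DenseRange.separableSpace (f := fun p : A × A =>
    toComplexification p.1 + Complex.I • toComplexification p.2) (Function.Surjective.denseRange
      fun w => ?_) ?_
  · obtain ⟨u, v, rfl⟩ := exists_eq_toComplexification_add w
    exact ⟨(u, v), rfl⟩
  · exact (hiso.continuous.comp continuous_fst).add
      ((hiso.continuous.comp continuous_snd).const_smul Complex.I)

end Separability

/-! ### Closable forms on Hilbert spaces -/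

section Closure

open scoped InnerProductSpace

/-- Bounded sets in a Hilbert space are weakly relatively compact: limits of images of bounded
sequences under a continuous linear map are images, with the expected norm bound. -/
lemma exists_eq_of_tendsto_map {H L : Type*} [NormedAddCommGroup H] [InnerProductSpace ℝ H]
    [CompleteSpace H] [NormedAddCommGroup L] [InnerProductSpace ℝ L] [CompleteSpace L]
    (J : H →L[ℝ] L) (h : ℕ → H) (w : L) (r : ℕ → ℝ) (r₀ : ℝ) (hr : Tendsto r atTop (𝓝 r₀))
    (hh : ∀ n, ‖h n‖ ≤ r n) (hw : Tendsto (fun n => J (h n)) atTop (𝓝 w)) :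
    ∃ k : H, J k = w ∧ ‖k‖ ≤ r₀ := by
  obtain ⟨C, hC⟩ := hr.bddAbove_range
  have hcomp := WeakDual.isCompact_closedBall (𝕜 := ℝ) (E := H) 0 C
  let F : Ultrafilter ℕ := Filter.hyperfilter ℕ
  have hF : (F : Filter ℕ) ≤ atTop := Nat.hyperfilter_le_atTop
  obtain ⟨φ, -, hφ⟩ := hcomp.ultrafilter_le_nhds
    (F.map fun n => StrongDual.toWeakDual (InnerProductSpace.toDual ℝ H (h n))) (by
      rw [le_principal_iff]
      refine Filter.mem_map.2 (Filter.univ_mem' fun n => ?_)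
      change InnerProductSpace.toDual ℝ H (h n) ∈ Metric.closedBall 0 C
      rw [mem_closedBall_zero_iff, LinearIsometryEquiv.norm_map]
      exact (hh n).trans (hC ⟨n, rfl⟩))
  have hlim : ∀ x : H, Tendsto (fun n => ⟪h n, x⟫_ℝ) F (𝓝 (φ x)) := fun x =>
    ((WeakDual.eval_continuous x).tendsto φ).comp hφ
  let k : H := (InnerProductSpace.toDual ℝ H).symm (WeakDual.toStrongDual φ)
  have hk : ∀ x, ⟪k, x⟫_ℝ = φ x := fun x => InnerProductSpace.toDual_symm_apply
  refine ⟨k, ext_inner_right ℝ fun l => ?_, ?_⟩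
  · rw [← ContinuousLinearMap.adjoint_inner_right, hk]
    refine tendsto_nhds_unique (hlim _) ?_
    simp_rw [ContinuousLinearMap.adjoint_inner_right]
    exact (hw.inner tendsto_const_nhds).mono_left hF
  · have h1 : ⟪k, k⟫_ℝ ≤ r₀ * ‖k‖ := by
      rw [hk]
      refine le_of_tendsto_of_tendsto' (hlim k) ((hr.mono_left hF).mul_const ‖k‖) fun n => ?_
      exact (real_inner_le_norm _ _).trans (mul_le_mul_of_nonneg_right (hh n) (norm_nonneg _))
    have h0 : 0 ≤ r₀ := ge_of_tendsto' hr fun n => (norm_nonneg _).trans (hh n)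
    rw [real_inner_self_eq_norm_mul_norm] at h1
    by_contra! hlt
    nlinarith [norm_nonneg k]

/-- The bilinear form on a subspace `K` of `L` whose form inner product `a(u, v) + ⟪u, v⟫` is
carried over from a Hilbert space `H` along a linear isomorphism. -/
def formOfEquiv {H L : Type*} [NormedAddCommGroup H] [InnerProductSpace ℝ H]
    [NormedAddCommGroup L] [InnerProductSpace ℝ L] {K : Submodule ℝ L} (e : K ≃ₗ[ℝ] H) :
    K →ₗ[ℝ] K →ₗ[ℝ] ℝ :=
  (innerₗ H).compl₁₂ e.toLinearMap e.toLinearMap - (innerₗ L).compl₁₂ K.subtype K.subtype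

lemma formOfEquiv_apply {H L : Type*} [NormedAddCommGroup H] [InnerProductSpace ℝ H]
    [NormedAddCommGroup L] [InnerProductSpace ℝ L] {K : Submodule ℝ L} (e : K ≃ₗ[ℝ] H) (u v : K) :
    formOfEquiv e u v = ⟪e u, e v⟫_ℝ - ⟪(u : L), (v : L)⟫_ℝ := rfl

lemma formOfEquiv_self_add {H L : Type*} [NormedAddCommGroup H] [InnerProductSpace ℝ H]
    [NormedAddCommGroup L] [InnerProductSpace ℝ L] {K : Submodule ℝ L} (e : K ≃ₗ[ℝ] H) (u : K) :
    formOfEquiv e u u + ‖u‖ ^ 2 = ‖e u‖ ^ 2 := by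
  rw [formOfEquiv_apply, real_inner_self_eq_norm_sq, real_inner_self_eq_norm_sq]
  simp

variable {V L : Type*} [AddCommGroup V] [Module ℝ V] [NormedAddCommGroup L] [InnerProductSpace ℝ L]

/-- If `√a, √b, √c` and `x, y, z` satisfy the triangle inequality, so do the norms of the vectors
`(√a, x)`, `(√b, y)`, `(√c, z)` of the plane. -/
lemma sqrt_add_sq_triangle {a b c x y z : ℝ} (ha : 0 ≤ a) (hb : 0 ≤ b) (hc0 : 0 ≤ c)
    (hz : 0 ≤ z) (hc : √c ≤ √a + √b) (hxy : z ≤ x + y) :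
    √(c + z ^ 2) ≤ √(a + x ^ 2) + √(b + y ^ 2) := by
  have ha' := Real.sqrt_nonneg a
  have hb' := Real.sqrt_nonneg b
  have h1 : √a * √b + x * y ≤ √(a + x ^ 2) * √(b + y ^ 2) := by
    rw [← Real.sqrt_mul (by positivity : 0 ≤ a + x ^ 2)]
    apply Real.le_sqrt_of_sq_le
    nlinarith [sq_nonneg (√a * y - x * √b), Real.sq_sqrt ha, Real.sq_sqrt hb]
  refine Real.sqrt_le_iff.2 ⟨by positivity, ?_⟩
  nlinarith [mul_self_le_mul_self (Real.sqrt_nonneg c) hc, mul_self_le_mul_self hz hxy,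
    Real.sq_sqrt ha, Real.sq_sqrt hb, Real.sq_sqrt hc0,
    Real.sq_sqrt (by positivity : 0 ≤ a + x ^ 2),
    Real.sq_sqrt (by positivity : 0 ≤ b + y ^ 2)]

/-- The closure of a closable form. The form domain is realised as the completion of `V` for the
norm `(q f + ‖J f‖²)^(1/2)`, and closability says that it maps injectively into `L`. -/
theorem exists_closure_of_closable [CompleteSpace L] (q : V → ℝ) (hq : ∀ f, 0 ≤ q f)
    (hsmul : ∀ (c : ℝ) f, q (c • f) = c ^ 2 * q f)
    (hpar : ∀ f g, q (f + g) + q (f - g) = 2 * q f + 2 * q g)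
    (htri : ∀ f g, √(q (f + g)) ≤ √(q f) + √(q g))
    (J : V →ₗ[ℝ] L) (hJ : Function.Injective J)
    (hclos : ∀ f : ℕ → V, (∀ ε > 0, ∃ N, ∀ m ≥ N, ∀ n ≥ N, q (f m - f n) < ε) →
      Tendsto (fun n => J (f n)) atTop (𝓝 0) → Tendsto (fun n => q (f n)) atTop (𝓝 0)) :
    ∃ (K : Submodule ℝ L) (a : K →ₗ[ℝ] K →ₗ[ℝ] ℝ) (j : V →ₗ[ℝ] K),
      (∀ f, (j f : L) = J f) ∧ (∀ f, a (j f) (j f) = q f) ∧ (∀ u v, a u v = a v u) ∧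
      (∀ u, 0 ≤ a u u) ∧
      (∀ u : ℕ → K, (∀ ε : ℝ, 0 < ε → ∃ N, ∀ m ≥ N, ∀ n ≥ N,
        a (u m - u n) (u m - u n) + ‖u m - u n‖ ^ 2 < ε) →
        ∃ v : K, Tendsto (fun n => a (u n - v) (u n - v) + ‖u n - v‖ ^ 2) atTop (𝓝 0)) ∧
      (∀ u : K, ∃ f : ℕ → V,
        Tendsto (fun n => a (u - j (f n)) (u - j (f n)) + ‖u - j (f n)‖ ^ 2) atTop (𝓝 0) ∧
        Tendsto (fun n => J (f n)) atTop (𝓝 (u : L)) ∧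
        Tendsto (fun n => q (f n)) atTop (𝓝 (a u u))) ∧
      (∀ (f : ℕ → V) (w : L) (r : ℕ → ℝ) (r₀ : ℝ), Tendsto (fun n => J (f n)) atTop (𝓝 w) →
        Tendsto r atTop (𝓝 r₀) → (∀ n, q (f n) ≤ r n) → ∃ u : K, (u : L) = w ∧ a u u ≤ r₀) := by
  let _ : Norm V := ⟨fun f => √(q f + ‖J f‖ ^ 2)⟩
  have hnorm : ∀ f : V, ‖f‖ = √(q f + ‖J f‖ ^ 2) := fun _ => rfl
  have hnonneg : ∀ f : V, 0 ≤ q f + ‖J f‖ ^ 2 := fun f => add_nonneg (hq f) (sq_nonneg _)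
  have core : NormedSpace.Core ℝ V :=
    { norm_nonneg := fun f => Real.sqrt_nonneg _
      norm_smul := fun c f => by
        rw [hnorm, hnorm, hsmul, map_smul, norm_smul, mul_pow, Real.norm_eq_abs, sq_abs, ← mul_add,
          Real.sqrt_mul (sq_nonneg c), Real.sqrt_sq_eq_abs]
      norm_triangle := fun f g => by
        rw [hnorm, hnorm, hnorm]
        exact sqrt_add_sq_triangle (hq f) (hq g) (hq _) (norm_nonneg _) (htri f g)
          (by rw [map_add]; exact norm_add_le _ _)
      norm_eq_zero_iff := fun f => by
        rw [hnorm, Real.sqrt_eq_zero (hnonneg f)]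
        constructor
        · intro h
          have h2 : ‖J f‖ ^ 2 = 0 := le_antisymm (by linarith [hq f]) (sq_nonneg _)
          exact hJ (by simpa using h2)
        · rintro rfl
          have h0 : q 0 = 0 := by simpa using hsmul 0 (0 : V)
          rw [h0, map_zero, norm_zero]
          norm_num }
  let _ : NormedAddCommGroup V := NormedAddCommGroup.ofCore core
  let _ : NormedSpace ℝ V := NormedSpace.ofCore core
  have hnormsq : ∀ f : V, ‖f‖ ^ 2 = q f + ‖J f‖ ^ 2 := fun f => Real.sq_sqrt (hnonneg f)
  have : InnerProductSpaceable V := ⟨fun f g => by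
    simp only [← pow_two, hnormsq, map_add, map_sub]
    have := parallelogram_law_with_norm_mul ℝ (J f) (J g)
    linarith [hpar f g]⟩
  let _ : InnerProductSpace ℝ V := InnerProductSpace.ofNorm ℝ this.parallelogram_identity
  let ι : V →L[ℝ] UniformSpace.Completion V := UniformSpace.Completion.toComplL
  have hι : ∀ f : V, ‖ι f‖ = ‖f‖ := UniformSpace.Completion.norm_coe
  have hdense : DenseRange ι := UniformSpace.Completion.denseRange_coe
  have hbound : ∀ f : V, ‖J f‖ ≤ 1 * ‖ι f‖ := fun f => by
    rw [one_mul, hι]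
    exact Real.le_sqrt_of_sq_le (by linarith [hq f])
  let J' : UniformSpace.Completion V →L[ℝ] L := J.extendOfNorm ι.toLinearMap
  have hJ' : ∀ f, J' (ι f) = J f := LinearMap.extendOfNorm_eq hdense ⟨1, hbound⟩
  have hJ'norm : ∀ h, ‖J' h‖ ≤ ‖h‖ := fun h => by
    simpa using LinearMap.norm_extendOfNorm_apply_le hdense 1 hbound h
  have hJ'inj : Function.Injective J' := by
    rw [injective_iff_map_eq_zero]
    intro h hh
    obtain ⟨x, hx, hxh⟩ := mem_closure_iff_seq_limit.1 (hdense h)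
    choose f hf using hx
    obtain rfl : (fun n => ι (f n)) = x := funext hf
    have hJlim : Tendsto (fun n => J (f n)) atTop (𝓝 0) := by
      have := (J'.continuous.tendsto h).comp hxh
      simpa only [Function.comp_def, hJ', hh] using this
    have hqlim := hclos f (fun ε hε => by
      obtain ⟨N, hN⟩ := Metric.cauchySeq_iff.1 hxh.cauchySeq (√ε) (Real.sqrt_pos.2 hε)
      refine ⟨N, fun m hm n hn => ?_⟩
      have h1 := hN m hm n hn
      rw [dist_eq_norm, ← map_sub, hι, hnorm] at h1
      have h2 := (Real.sqrt_lt_sqrt_iff (hnonneg _)).1 h1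
      nlinarith [sq_nonneg ‖J (f m - f n)‖]) hJlim
    have h3 : Tendsto (fun n => ‖ι (f n)‖) atTop (𝓝 0) := by
      have := ((hqlim.add (hJlim.norm.pow 2)).sqrt)
      simpa [hι, hnorm] using this
    exact tendsto_nhds_unique hxh (tendsto_zero_iff_norm_tendsto_zero.2 h3)
  let e : UniformSpace.Completion V ≃ₗ[ℝ] LinearMap.range J'.toLinearMap :=
    LinearEquiv.ofInjective J'.toLinearMap hJ'inj
  have he : ∀ h, ((e h : LinearMap.range J'.toLinearMap) : L) = J' h := fun h => rfl
  refine ⟨LinearMap.range J'.toLinearMap, formOfEquiv e.symm,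
    e.toLinearMap ∘ₗ ι.toLinearMap, hJ', fun f => ?_, fun u v => ?_, fun u => ?_, fun u hu => ?_,
    fun u => ?_, fun f w r r₀ hfw hr hqr => ?_⟩
  · rw [formOfEquiv_apply, real_inner_self_eq_norm_sq, real_inner_self_eq_norm_sq]
    simp only [LinearMap.comp_apply, LinearEquiv.coe_coe, LinearEquiv.symm_apply_apply,
      ContinuousLinearMap.coe_coe, he, hJ', hι, hnormsq]
    ring
  · rw [formOfEquiv_apply, formOfEquiv_apply, real_inner_comm, real_inner_comm (v : L)]
  · obtain ⟨h, rfl⟩ := e.surjective u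
    rw [formOfEquiv_apply, real_inner_self_eq_norm_sq, real_inner_self_eq_norm_sq,
      LinearEquiv.symm_apply_apply, he]
    nlinarith [hJ'norm h, norm_nonneg (J' h)]
  · simp only [formOfEquiv_self_add] at hu ⊢
    have hcau : CauchySeq fun n => e.symm (u n) := by
      refine Metric.cauchySeq_iff.2 fun ε hε => ?_
      obtain ⟨N, hN⟩ := hu (ε ^ 2) (by positivity)
      refine ⟨N, fun m hm n hn => ?_⟩
      rw [dist_eq_norm, ← map_sub]
      exact lt_of_pow_lt_pow_left₀ 2 hε.le (hN m hm n hn)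
    obtain ⟨h, hh⟩ := cauchySeq_tendsto_of_complete hcau
    refine ⟨e h, ?_⟩
    simp only [map_sub, LinearEquiv.symm_apply_apply]
    simpa using (tendsto_iff_norm_sub_tendsto_zero.1 hh).pow 2
  · obtain ⟨h, rfl⟩ := e.surjective u
    obtain ⟨x, hx, hxh⟩ := mem_closure_iff_seq_limit.1 (hdense h)
    choose f hf using hx
    obtain rfl : (fun n => ι (f n)) = x := funext hf
    have hJlim : Tendsto (fun n => J (f n)) atTop (𝓝 (J' h)) := by
      simpa only [Function.comp_def, hJ'] using (J'.continuous.tendsto h).comp hxh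
    refine ⟨f, ?_, hJlim, ?_⟩
    · simp only [formOfEquiv_self_add]
      simp only [map_sub, LinearMap.comp_apply, LinearEquiv.coe_coe,
        LinearEquiv.symm_apply_apply, ContinuousLinearMap.coe_coe]
      simpa [norm_sub_rev] using (tendsto_iff_norm_sub_tendsto_zero.1 hxh).pow 2
    · have h1 := (hxh.norm.pow 2).sub (hJlim.norm.pow 2)
      simp only [hι, hnormsq, add_sub_cancel_right] at h1
      rwa [formOfEquiv_apply, real_inner_self_eq_norm_sq, real_inner_self_eq_norm_sq,
        LinearEquiv.symm_apply_apply, he]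
  · obtain ⟨k, hk, hkn⟩ := exists_eq_of_tendsto_map J' (fun n => ι (f n)) w
      (fun n => √(r n + ‖J (f n)‖ ^ 2)) (√(r₀ + ‖w‖ ^ 2)) ((hr.add (hfw.norm.pow 2)).sqrt)
      (fun n => by
        rw [hι, hnorm]
        exact Real.sqrt_le_sqrt (by linarith [hqr n])) (by simpa only [hJ'] using hfw)
    refine ⟨e k, hk, ?_⟩
    have h1 := formOfEquiv_self_add e.symm (e k)
    have h0 : 0 ≤ r₀ := ge_of_tendsto' hr fun n => (hq _).trans (hqr n)
    rw [LinearEquiv.symm_apply_apply] at h1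
    have h2 := (Real.le_sqrt (norm_nonneg k) (by positivity)).1 hkn
    have h3 : ‖e k‖ = ‖w‖ := congrArg norm hk
    rw [h3] at h1
    linarith

end Closure

/-! ### Lower semicontinuous forms as suprema of continuous functionals -/

section Duality

variable {V : Type*} [NormedAddCommGroup V] [NormedSpace ℝ V] {q : V → ℝ≥0∞}

/-- The triangle inequality for `√q` makes the unit ball `{q ≤ 1}` convex. -/
lemma convex_setOf_le_one
    (hsmul : ∀ (c : ℝ) f, q (c • f) = ENNReal.ofReal (c ^ 2) * q f)
    (htri : ∀ f g, q (f + g) ^ (1 / 2 : ℝ) ≤ q f ^ (1 / 2 : ℝ) + q g ^ (1 / 2 : ℝ)) :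
    Convex ℝ {f | q f ≤ 1} := by
  have hs : ∀ (c : ℝ) f, 0 ≤ c → q f ≤ 1 → q (c • f) ^ (1 / 2 : ℝ) ≤ ENNReal.ofReal c := by
    intro c f hc hf
    rw [hsmul]
    calc (ENNReal.ofReal (c ^ 2) * q f) ^ (1 / 2 : ℝ)
        ≤ (ENNReal.ofReal (c ^ 2) * 1) ^ (1 / 2 : ℝ) := by gcongr
      _ = ENNReal.ofReal c := by
        rw [mul_one, ENNReal.ofReal_rpow_of_nonneg (by positivity) (by positivity),
          ← Real.sqrt_eq_rpow, Real.sqrt_sq hc]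
  intro f hf g hg s t hs0 ht0 hst
  have h : q (s • f + t • g) ^ (1 / 2 : ℝ) ≤ 1 ^ (1 / 2 : ℝ) :=
    calc q (s • f + t • g) ^ (1 / 2 : ℝ) ≤ ENNReal.ofReal s + ENNReal.ofReal t :=
          (htri _ _).trans (add_le_add (hs s f hs0 hf) (hs t g ht0 hg))
      _ = 1 ^ (1 / 2 : ℝ) := by rw [← ENNReal.ofReal_add hs0 ht0, hst]; simp
  exact (ENNReal.rpow_le_rpow_iff (by norm_num)).1 h

lemma isClosed_setOf_le_one {V : Type*} [NormedAddCommGroup V] {q : V → ℝ≥0∞}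
    (hlsc : ∀ (f : ℕ → V) (g : V), Tendsto f atTop (𝓝 g) →
    q g ≤ liminf (fun n => q (f n)) atTop) : IsClosed {f | q f ≤ 1} := by
  refine IsSeqClosed.isClosed fun f g hf hg => (hlsc f g hg).trans ?_
  exact (liminf_le_liminf (Eventually.of_forall hf)).trans (by simp)

/-- Hahn–Banach: a point outside the unit ball of `q` is separated from it. -/
lemma exists_functional_of_one_lt (hsmul : ∀ (c : ℝ) f, q (c • f) = ENNReal.ofReal (c ^ 2) * q f)
    (hconv : Convex ℝ {f | q f ≤ 1}) (hclosed : IsClosed {f | q f ≤ 1}) {f : V} (hf : 1 < q f) :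
    ∃ l : V →L[ℝ] ℝ, (∀ g, q g ≤ 1 → |l g| ≤ 1) ∧ 1 < |l f| := by
  obtain ⟨l, u, hl, hlf⟩ := geometric_hahn_banach_closed_point hconv hclosed
    (x := f) (by simpa using hf)
  have h0 : q 0 ≤ 1 := by simpa using (hsmul 0 (0 : V)).le.trans (by simp)
  have hu : 0 < u := by simpa using hl 0 h0
  refine ⟨u⁻¹ • l, fun g hg => ?_, ?_⟩
  · have h1 := hl g hg
    have h2 := hl (-g) (by
      have h3 := hsmul (-1) g
      rw [neg_one_smul, neg_one_sq, ENNReal.ofReal_one, one_mul] at h3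
      simpa [h3] using hg)
    rw [map_neg] at h2
    rw [smul_apply, smul_eq_mul, abs_mul, abs_of_pos (inv_pos.2 hu),
      inv_mul_le_one₀ hu, abs_le]
    constructor <;> linarith
  · rw [smul_apply, smul_eq_mul]
    refine lt_of_lt_of_le ?_ (le_abs_self _)
    rwa [← div_eq_inv_mul, one_lt_div hu]

/-- A lower semicontinuous `q` with `√q` subadditive is a supremum of squares of countably many
continuous functionals. By the Lindelöf property countably many suffice. -/
theorem exists_seq_functional [SecondCountableTopology V]
    (hsmul : ∀ (c : ℝ) f, q (c • f) = ENNReal.ofReal (c ^ 2) * q f)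
    (htri : ∀ f g, q (f + g) ^ (1 / 2 : ℝ) ≤ q f ^ (1 / 2 : ℝ) + q g ^ (1 / 2 : ℝ))
    (hlsc : ∀ (f : ℕ → V) (g : V), Tendsto f atTop (𝓝 g) →
      q g ≤ liminf (fun n => q (f n)) atTop) :
    ∃ l : ℕ → V →L[ℝ] ℝ, ∀ (t : ℝ) f, 0 < t →
      (q f ≤ ENNReal.ofReal (t ^ 2) ↔ ∀ n, |l n f| ≤ t) := by
  let S := {l : V →L[ℝ] ℝ // ∀ g, q g ≤ 1 → |l g| ≤ 1}
  have : Nonempty S := ⟨0, fun g _ => by simp⟩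
  obtain ⟨T, hT, hTU⟩ := TopologicalSpace.isOpen_iUnion_countable
    (fun l : S => {f : V | 1 < |l.1 f|})
    fun l => isOpen_lt continuous_const l.1.continuous.abs
  obtain ⟨l, hl⟩ := (hT.union (Set.countable_singleton (Classical.arbitrary S))).exists_eq_range
    ⟨_, Or.inr rfl⟩
  -- the case `t = 1`, to which the general one reduces by scaling
  have key : ∀ f, q f ≤ 1 ↔ ∀ n, |(l n).1 f| ≤ 1 := by
    refine fun f => ⟨fun hf n => (l n).2 f hf, fun hf => ?_⟩
    by_contra! hlt
    obtain ⟨k, hk, hkf⟩ := exists_functional_of_one_lt hsmul (convex_setOf_le_one hsmul htri)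
      (isClosed_setOf_le_one hlsc) hlt
    have hmem : f ∈ ⋃ l : S, {f : V | 1 < |l.1 f|} := Set.mem_iUnion.2 ⟨⟨k, hk⟩, hkf⟩
    rw [← hTU] at hmem
    simp only [Set.mem_iUnion] at hmem
    obtain ⟨k', hk', hkf'⟩ := hmem
    obtain ⟨n, rfl⟩ : k' ∈ Set.range l := hl ▸ Or.inl hk'
    exact absurd (hf n) (not_le.2 hkf')
  refine ⟨fun n => (l n).1, fun t f ht => ?_⟩
  have h := key (t⁻¹ • f)
  have ht2 : ENNReal.ofReal (t⁻¹ ^ 2) = (ENNReal.ofReal (t ^ 2))⁻¹ := by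
    rw [inv_pow, ENNReal.ofReal_inv_of_pos (by positivity)]
  rw [hsmul, ht2, mul_comm, ← div_eq_mul_inv, ENNReal.div_le_iff (by simpa using ht.ne')
    ENNReal.ofReal_ne_top, one_mul] at h
  rw [h]
  refine forall_congr' fun n => ?_
  rw [map_smul, smul_eq_mul, abs_mul, abs_of_pos (inv_pos.2 ht), inv_mul_le_one₀ ht]

end Duality

/-! ### Functionals on `C₀` are dominated by finite measures -/

section SoftThreshold

/-- Soft thresholding: the value is moved towards zero by `ε`. -/
def softThreshold (ε t : ℝ) : ℝ := t - max (min t ε) (-ε)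

lemma continuous_softThreshold (ε : ℝ) : Continuous (softThreshold ε) := by
  unfold softThreshold
  fun_prop

lemma softThreshold_eq_zero {ε t : ℝ} (h : |t| ≤ ε) : softThreshold ε t = 0 := by
  rw [abs_le] at h
  rw [softThreshold, min_eq_left h.2, max_eq_left h.1, sub_self]

lemma abs_softThreshold_sub_le {ε : ℝ} (hε : 0 ≤ ε) (t : ℝ) : |softThreshold ε t - t| ≤ ε := by
  rw [softThreshold, abs_le]
  constructor
  · linarith [max_le (min_le_right t ε) (neg_le_self hε)]
  · linarith [le_max_right (min t ε) (-ε)]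

lemma abs_softThreshold_sub_softThreshold_le (ε s t : ℝ) :
    |softThreshold ε s - softThreshold ε t| ≤ |s - t| := by
  unfold softThreshold
  rw [abs_le]
  rcases abs_cases (s - t) with h | h <;> rcases max_cases (min s ε) (-ε) with h1 | h1 <;>
    rcases max_cases (min t ε) (-ε) with h2 | h2 <;> rcases min_cases s ε with h3 | h3 <;>
    rcases min_cases t ε with h4 | h4 <;> constructor <;> linarith

lemma softThreshold_zero {ε : ℝ} (hε : 0 ≤ ε) : softThreshold ε 0 = 0 :=
  softThreshold_eq_zero (by simpa using hε)

lemma abs_softThreshold_le {ε : ℝ} (hε : 0 ≤ ε) (t : ℝ) : |softThreshold ε t| ≤ |t| := by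
  simpa [softThreshold_zero hε] using abs_softThreshold_sub_softThreshold_le ε t 0

variable {Y : Type*} [TopologicalSpace Y]

lemma isCompact_setOf_le_abs (f : C₀(Y, ℝ)) {ε : ℝ} (hε : 0 < ε) : IsCompact {y | ε ≤ |f y|} := by
  obtain ⟨K, hK, hKf⟩ := Filter.mem_cocompact.1
    ((Metric.tendsto_nhds.1 f.zero_at_infty') ε hε)
  refine hK.of_isClosed_subset (isClosed_le continuous_const f.continuous.abs) fun y hy => ?_
  by_contra hyK
  have h1 : dist (f y) 0 < ε := hKf hyK
  rw [dist_zero_right, Real.norm_eq_abs] at h1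
  exact absurd hy (not_le.2 h1)

/-- Soft thresholding turns functions vanishing at infinity into functions with compact support. -/
def softThresholdComp (f : C₀(Y, ℝ)) {ε : ℝ} (hε : 0 < ε) : C_c(Y, ℝ) where
  toFun y := softThreshold ε (f y)
  continuous_toFun := (continuous_softThreshold ε).comp f.continuous
  hasCompactSupport' := by
    refine (isCompact_setOf_le_abs f hε).of_isClosed_subset (isClosed_tsupport _) ?_
    refine closure_minimal (fun y hy => ?_) (isClosed_le continuous_const f.continuous.abs)
    by_contra hlt
    exact hy (softThreshold_eq_zero (not_le.1 hlt).le)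

lemma softThresholdComp_apply (f : C₀(Y, ℝ)) {ε : ℝ} (hε : 0 < ε) (y : Y) :
    softThresholdComp f hε y = softThreshold ε (f y) := rfl

/-- The inclusion of `C_c` into `C₀`. -/
def toZeroAtInfty (f : C_c(Y, ℝ)) : C₀(Y, ℝ) where
  toFun := f
  continuous_toFun := f.continuous
  zero_at_infty' := f.hasCompactSupport.is_zero_at_infty

lemma norm_le_of_forall_abs_le {f : C₀(Y, ℝ)} {C : ℝ} (hC : 0 ≤ C) (h : ∀ y, |f y| ≤ C) :
    ‖f‖ ≤ C := by
  rw [← ZeroAtInftyContinuousMap.norm_toBCF_eq_norm]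
  exact (BoundedContinuousFunction.norm_le hC).2 h

lemma abs_apply_le_norm (f : C₀(Y, ℝ)) (y : Y) : |f y| ≤ ‖f‖ := by
  rw [← ZeroAtInftyContinuousMap.norm_toBCF_eq_norm]
  exact f.toBCF.norm_coe_le_norm y

lemma tendsto_softThresholdComp (f : C₀(Y, ℝ)) :
    Tendsto (fun n : ℕ => toZeroAtInfty (softThresholdComp f (Nat.one_div_pos_of_nat (n := n))))
      atTop (𝓝 f) := by
  rw [tendsto_iff_norm_sub_tendsto_zero]
  have hle : ∀ n : ℕ, ‖toZeroAtInfty (softThresholdComp f (Nat.one_div_pos_of_nat (n := n))) - f‖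
      ≤ 1 / ((n : ℝ) + 1) := fun n =>
    norm_le_of_forall_abs_le Nat.one_div_pos_of_nat.le fun y =>
      abs_softThreshold_sub_le Nat.one_div_pos_of_nat.le (f y)
  exact squeeze_zero (fun n => norm_nonneg _) hle tendsto_one_div_add_atTop_nhds_zero_nat

lemma integrable_abs [MeasurableSpace Y] [BorelSpace Y]
    (μ : Measure Y) [IsFiniteMeasure μ] (f : C₀(Y, ℝ)) :
    Integrable (fun y => |f y|) μ :=
  Integrable.of_bound f.continuous.abs.aestronglyMeasurable ‖f‖
    (Eventually.of_forall fun y => by simpa using abs_apply_le_norm f y)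

end SoftThreshold

section TotalVariation

open scoped NNReal Pointwise

variable {Y : Type*} [TopologicalSpace Y]

/-- The values of a functional on the functions dominated by `h`. Their supremum is the value at
`h` of the total variation of the functional. -/
def variationSet (l : C₀(Y, ℝ) →L[ℝ] ℝ) (h : C_c(Y, ℝ≥0)) : Set ℝ :=
  {r | ∃ g : C₀(Y, ℝ), (∀ y, |g y| ≤ h y) ∧ l g = r}

lemma zero_mem_variationSet (l : C₀(Y, ℝ) →L[ℝ] ℝ) (h : C_c(Y, ℝ≥0)) : 0 ∈ variationSet l h :=
  ⟨0, fun y => by simp, map_zero l⟩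

lemma le_of_mem_variationSet (l : C₀(Y, ℝ) →L[ℝ] ℝ) {h : C_c(Y, ℝ≥0)} {C : ℝ} (hC : 0 ≤ C)
    (hh : ∀ y, (h y : ℝ) ≤ C) {r : ℝ} (hr : r ∈ variationSet l h) : r ≤ ‖l‖ * C := by
  obtain ⟨g, hg, rfl⟩ := hr
  exact (le_abs_self _).trans ((l.le_opNorm g).trans (mul_le_mul_of_nonneg_left
    (norm_le_of_forall_abs_le hC fun y => (hg y).trans (hh y)) (norm_nonneg _)))

lemma bddAbove_variationSet (l : C₀(Y, ℝ) →L[ℝ] ℝ) (h : C_c(Y, ℝ≥0)) :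
    BddAbove (variationSet l h) := by
  obtain ⟨C, hC⟩ := (h.hasCompactSupport.comp_left (g := NNReal.toReal)
    rfl).exists_bound_of_continuous (NNReal.continuous_coe.comp h.continuous)
  refine ⟨‖l‖ * max C 0, fun r hr =>
    le_of_mem_variationSet l (le_max_right _ _) (fun y => ?_) hr⟩
  exact le_max_of_le_left ((le_abs_self _).trans (hC y))

/-- The Riesz decomposition property of `C₀`. -/
lemma exists_add_eq_of_abs_le (g : C₀(Y, ℝ)) (h₁ h₂ : C_c(Y, ℝ≥0))
    (hg : ∀ y, |g y| ≤ h₁ y + h₂ y) :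
    ∃ g₁ g₂ : C₀(Y, ℝ), g₁ + g₂ = g ∧ (∀ y, |g₁ y| ≤ h₁ y) ∧ ∀ y, |g₂ y| ≤ h₂ y := by
  have hcont : Continuous fun y => max (min (g y) (h₁ y)) (-(h₁ y : ℝ)) := by
    have h1 := h₁.continuous
    have h2 := g.continuous
    fun_prop
  have hle : ∀ y, |max (min (g y) (h₁ y)) (-(h₁ y : ℝ))| ≤ h₁ y := fun y => by
    rw [abs_le]
    exact ⟨le_max_right _ _, max_le (min_le_right _ _) (neg_le_self (h₁ y).2)⟩
  let c : C_c(Y, ℝ) :=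
    { toFun := fun y => max (min (g y) (h₁ y)) (-(h₁ y : ℝ))
      continuous_toFun := hcont
      hasCompactSupport' := h₁.hasCompactSupport.mono fun y hy hy0 => hy
        (abs_nonpos_iff.1 ((hle y).trans (by rw [hy0]; simp))) }
  refine ⟨toZeroAtInfty c, g - toZeroAtInfty c, by abel, hle, fun y => ?_⟩
  change |g y - max (min (g y) (h₁ y)) (-(h₁ y : ℝ))| ≤ h₂ y
  have h3 := hg y
  have h4 := (h₁ y).2
  have h5 := (h₂ y).2
  simp only [NNReal.val_eq_coe] at h4 h5
  rw [abs_le] at h3 ⊢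
  rcases max_cases (min (g y) (h₁ y)) (-(h₁ y : ℝ)) with h | h <;>
    rcases min_cases (g y) (h₁ y : ℝ) with h' | h' <;> constructor <;> linarith [h3.1, h3.2]

lemma variationSet_add (l : C₀(Y, ℝ) →L[ℝ] ℝ) (h₁ h₂ : C_c(Y, ℝ≥0)) :
    variationSet l (h₁ + h₂) = variationSet l h₁ + variationSet l h₂ := by
  ext r
  rw [Set.mem_add]
  constructor
  · rintro ⟨g, hg, rfl⟩
    obtain ⟨g₁, g₂, rfl, hg₁, hg₂⟩ := exists_add_eq_of_abs_le g h₁ h₂ (by simpa using hg)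
    exact ⟨_, ⟨g₁, hg₁, rfl⟩, _, ⟨g₂, hg₂, rfl⟩, (map_add l _ _).symm⟩
  · rintro ⟨_, ⟨g₁, hg₁, rfl⟩, _, ⟨g₂, hg₂, rfl⟩, rfl⟩
    refine ⟨g₁ + g₂, fun y => ?_, map_add l _ _⟩
    simpa using (abs_add_le (g₁ y) (g₂ y)).trans (add_le_add (hg₁ y) (hg₂ y))

lemma variationSet_smul (l : C₀(Y, ℝ) →L[ℝ] ℝ) (c : ℝ≥0) (h : C_c(Y, ℝ≥0)) :
    variationSet l (c • h) = (c : ℝ) • variationSet l h := by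
  ext r
  rw [Set.mem_smul_set]
  constructor
  · rintro ⟨g, hg, rfl⟩
    rcases eq_or_ne c 0 with rfl | hc
    · refine ⟨0, zero_mem_variationSet l h, ?_⟩
      have : g = 0 := by
        ext y
        simpa using hg y
      simp [this]
    · have hc' : (0 : ℝ) < c := by positivity
      refine ⟨_, ⟨(c : ℝ)⁻¹ • g, fun y => ?_, rfl⟩, ?_⟩
      · have := hg y
        simp only [CompactlySupportedContinuousMap.smul_apply, smul_eq_mul, NNReal.coe_mul] at this
        rw [ZeroAtInftyContinuousMap.smul_apply, smul_eq_mul, abs_mul, abs_inv, abs_of_pos hc',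
          inv_mul_le_iff₀ hc']
        exact this
      · rw [map_smul, smul_smul, mul_inv_cancel₀ hc'.ne', one_smul]
  · rintro ⟨_, ⟨g, hg, rfl⟩, rfl⟩
    refine ⟨(c : ℝ) • g, fun y => ?_, map_smul l _ _⟩
    simpa [abs_mul] using mul_le_mul_of_nonneg_left (hg y) c.2

/-- The total variation of a continuous functional, as a positive functional. -/
def totalVariation (l : C₀(Y, ℝ) →L[ℝ] ℝ) : C_c(Y, ℝ≥0) →ₗ[ℝ≥0] ℝ≥0 where
  toFun h := ⟨sSup (variationSet l h),
    le_csSup (bddAbove_variationSet l h) (zero_mem_variationSet l h)⟩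
  map_add' h₁ h₂ := by
    refine NNReal.eq ?_
    change sSup (variationSet l (h₁ + h₂)) = sSup _ + sSup _
    rw [variationSet_add, csSup_add ⟨0, zero_mem_variationSet l h₁⟩ (bddAbove_variationSet l h₁)
      ⟨0, zero_mem_variationSet l h₂⟩ (bddAbove_variationSet l h₂)]
  map_smul' c h := by
    refine NNReal.eq ?_
    change sSup (variationSet l (c • h)) = c * sSup _
    rw [variationSet_smul, Real.sSup_smul_of_nonneg (NNReal.coe_nonneg c), smul_eq_mul]

lemma coe_totalVariation (l : C₀(Y, ℝ) →L[ℝ] ℝ) (h : C_c(Y, ℝ≥0)) :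
    (totalVariation l h : ℝ) = sSup (variationSet l h) := rfl

variable [T2Space Y] [LocallyCompactSpace Y] [MeasurableSpace Y] [BorelSpace Y]

lemma isFiniteMeasure_rieszMeasure_totalVariation (l : C₀(Y, ℝ) →L[ℝ] ℝ) :
    IsFiniteMeasure (NNRealRMK.rieszMeasure (totalVariation l)) := by
  refine ⟨lt_of_le_of_lt (b := ENNReal.ofReal ‖l‖) ?_ ENNReal.ofReal_lt_top⟩
  rw [isOpen_univ.measure_eq_iSup_isCompact]
  refine iSup₂_le fun K _ => iSup_le fun hK => ?_
  obtain ⟨f, hfK, -, hfc, hf01⟩ :=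
    exists_continuous_one_zero_of_isCompact hK isClosed_empty (Set.disjoint_empty K)
  let h : C_c(Y, ℝ≥0) :=
    { toFun := fun y => (f y).toNNReal
      continuous_toFun := by fun_prop
      hasCompactSupport' := hfc.comp_left (g := Real.toNNReal) Real.toNNReal_zero }
  calc NNRealRMK.rieszMeasure (totalVariation l) K
      = ∫⁻ y in K, 1 ∂(NNRealRMK.rieszMeasure (totalVariation l)) := by simp
    _ ≤ ∫⁻ y in K, h y ∂(NNRealRMK.rieszMeasure (totalVariation l)) := by
        refine setLIntegral_mono' hK.measurableSet fun y hy => ?_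
        have : h y = 1 := by
          change (f y).toNNReal = 1
          rw [hfK hy]
          simp
        simp [this]
    _ ≤ ∫⁻ y, h y ∂(NNRealRMK.rieszMeasure (totalVariation l)) := setLIntegral_le_lintegral _ _
    _ = totalVariation l h := NNRealRMK.lintegral_rieszMeasure _ _
    _ ≤ ENNReal.ofReal ‖l‖ := by
        rw [← ENNReal.ofReal_coe_nnreal, coe_totalVariation]
        refine ENNReal.ofReal_le_ofReal (csSup_le ⟨0, zero_mem_variationSet l h⟩ fun r hr => ?_)
        simpa using le_of_mem_variationSet l zero_le_one (fun y => by
          change ((f y).toNNReal : ℝ) ≤ 1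
          rw [Real.coe_toNNReal _ (hf01 y).1]
          exact (hf01 y).2) hr

lemma abs_apply_toZeroAtInfty_le (l : C₀(Y, ℝ) →L[ℝ] ℝ) (f : C_c(Y, ℝ)) :
    |l (toZeroAtInfty f)| ≤ ∫ y, |f y| ∂(NNRealRMK.rieszMeasure (totalVariation l)) := by
  let h : C_c(Y, ℝ≥0) :=
    { toFun := fun y => ⟨|f y|, abs_nonneg _⟩
      continuous_toFun := f.continuous.abs.subtype_mk _
      hasCompactSupport' := f.hasCompactSupport.comp_left (g := Real.nnabs) (map_zero _) }
  have h1 : ∫ y, |f y| ∂(NNRealRMK.rieszMeasure (totalVariation l)) = totalVariation l h :=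
    NNRealRMK.integral_rieszMeasure (totalVariation l) h
  rw [h1, coe_totalVariation, abs_le']
  exact ⟨le_csSup (bddAbove_variationSet l h) ⟨toZeroAtInfty f, fun y => le_rfl, rfl⟩,
    le_csSup (bddAbove_variationSet l h)
      ⟨-toZeroAtInfty f, fun y => (abs_neg (f y)).le, map_neg l _⟩⟩

/-- The easy half of the Riesz representation theorem for signed functionals: domination by the
measure of the total variation. -/
theorem exists_measure_abs_le_integral (l : C₀(Y, ℝ) →L[ℝ] ℝ) :
    ∃ μ : Measure Y, IsFiniteMeasure μ ∧ ∀ f : C₀(Y, ℝ), |l f| ≤ ∫ y, |f y| ∂μ := by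
  have hfin := isFiniteMeasure_rieszMeasure_totalVariation l
  refine ⟨NNRealRMK.rieszMeasure (totalVariation l), hfin, fun f => ?_⟩
  refine le_of_tendsto ((l.continuous.tendsto f).comp (tendsto_softThresholdComp f)).abs
    (Eventually.of_forall fun n => (abs_apply_toZeroAtInfty_le l _).trans ?_)
  have hε : 0 < 1 / ((n : ℝ) + 1) := Nat.one_div_pos_of_nat
  have hint : Integrable (fun y => |softThresholdComp f hε y|)
      (NNRealRMK.rieszMeasure (totalVariation l)) :=
    integrable_abs _ (toZeroAtInfty (softThresholdComp f hε))
  refine integral_mono hint (integrable_abs _ f) fun y => ?_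
  exact abs_softThreshold_le hε.le (f y)

end TotalVariation

/-! ### A reference measure for which the form is closable -/

section ReferenceMeasure

open scoped NNReal

/-- Countably many finite measures are dominated, with bounded densities, by a single one. -/
lemma exists_isFiniteMeasure_le_smul {Y : Type*} [MeasurableSpace Y] (μ : ℕ → Measure Y)
    [∀ n, IsFiniteMeasure (μ n)] :
    ∃ m : Measure Y, IsFiniteMeasure m ∧ ∀ n, ∃ C : ℝ≥0, μ n ≤ C • m := by
  obtain ⟨δ, hδ, hsum⟩ := ENNReal.exists_pos_tsum_mul_lt_of_countable one_ne_zero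
    (fun n => μ n Set.univ) fun n => measure_ne_top _ _
  refine ⟨Measure.sum fun n => δ n • μ n, ⟨?_⟩, fun n => ⟨(δ n)⁻¹, ?_⟩⟩
  · rw [Measure.sum_apply _ MeasurableSet.univ]
    refine lt_of_le_of_lt (le_of_eq (tsum_congr fun n => ?_)) (hsum.trans ENNReal.one_lt_top)
    rw [Measure.smul_apply, mul_comm]
    rfl
  · calc μ n = (δ n)⁻¹ • (δ n • μ n) := by
          rw [smul_smul, inv_mul_cancel₀ (hδ n).ne', one_smul]
      _ ≤ (δ n)⁻¹ • Measure.sum fun n => δ n • μ n := by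
          gcongr
          exact Measure.le_sum (fun n => δ n • μ n) n

variable {Y : Type*} [TopologicalSpace Y] [T2Space Y] [LocallyCompactSpace Y] [MeasurableSpace Y]
  [BorelSpace Y]

/-- A single finite measure of full support that controls countably many functionals. Diracs at a
dense sequence provide the full support. -/
theorem exists_measure_forall_abs_le [TopologicalSpace.SeparableSpace Y] [Nonempty Y]
    (l : ℕ → C₀(Y, ℝ) →L[ℝ] ℝ) :
    ∃ m : Measure Y, IsFiniteMeasure m ∧ m.IsOpenPosMeasure ∧
      ∀ n, ∃ C : ℝ, ∀ f : C₀(Y, ℝ), |l n f| ≤ C * ∫ y, |f y| ∂m := by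
  choose μ hμ hμl using fun n => exists_measure_abs_le_integral (l n)
  let ν : ℕ → Measure Y := fun n => μ n + Measure.dirac (TopologicalSpace.denseSeq Y n)
  obtain ⟨m, hm, hmν⟩ := exists_isFiniteMeasure_le_smul ν
  refine ⟨m, hm, ⟨fun U hU hne h0 => ?_⟩, fun n => ?_⟩
  · obtain ⟨n, hn⟩ := (TopologicalSpace.denseRange_denseSeq Y).exists_mem_open hU hne
    obtain ⟨C, hC⟩ := hmν n
    have h1 := hC U
    have h2 : Measure.dirac (TopologicalSpace.denseSeq Y n) U = 1 :=
      Measure.dirac_apply_of_mem hn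
    rw [Measure.smul_apply, h0, smul_zero, Measure.add_apply, h2] at h1
    simp at h1
  · obtain ⟨C, hC⟩ := hmν n
    refine ⟨C, fun f => (hμl n f).trans ?_⟩
    have hle : μ n ≤ C • m := (Measure.le_add_right le_rfl).trans hC
    calc ∫ y, |f y| ∂(μ n) ≤ ∫ y, |f y| ∂(C • m) :=
          integral_mono_measure hle (Eventually.of_forall fun y => abs_nonneg _)
            (integrable_abs _ f)
      _ = C * ∫ y, |f y| ∂m := by rw [integral_smul_nnreal_measure]; rfl

end ReferenceMeasure

/-! ### Functions vanishing at infinity as elements of `L²` -/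

section ToL2

variable {Y : Type*} [TopologicalSpace Y] [MeasurableSpace Y] [BorelSpace Y] (m : Measure Y)
  [IsFiniteMeasure m]

/-- The map sending a function vanishing at infinity to its class in `L²` of a finite measure. -/
def toL2 : C₀(Y, ℝ) →L[ℝ] Lp ℝ 2 m :=
  (BoundedContinuousFunction.toLp 2 m ℝ).comp
    ({ toFun := ZeroAtInftyContinuousMap.toBCF
       map_add' := fun _ _ => rfl
       map_smul' := fun _ _ => rfl
       cont := ZeroAtInftyContinuousMap.isometry_toBCF.continuous } : C₀(Y, ℝ) →L[ℝ] (Y →ᵇ ℝ))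

lemma coeFn_toL2 (f : C₀(Y, ℝ)) : (toL2 m f : Y → ℝ) =ᵐ[m] f :=
  BoundedContinuousFunction.coeFn_toLp 2 m ℝ f.toBCF

lemma toL2_injective [m.IsOpenPosMeasure] : Function.Injective (toL2 m) := fun _ _ h =>
  ZeroAtInftyContinuousMap.toBCF_injective _ _
    ((BoundedContinuousFunction.toLp_inj m (𝕜 := ℝ) (p := 2)).1 h)

lemma integral_abs_le (f : C₀(Y, ℝ)) :
    ∫ y, |f y| ∂m ≤ (m Set.univ ^ (1 / 2 : ℝ)).toReal * ‖toL2 m f‖ := by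
  have hmeas : AEStronglyMeasurable (fun y => |f y|) m := f.continuous.abs.aestronglyMeasurable
  have h1 : ∫ y, |f y| ∂m = (eLpNorm (toL2 m f) 1 m).toReal := by
    rw [eLpNorm_congr_ae (coeFn_toL2 m f), eLpNorm_one_eq_lintegral_enorm,
      integral_eq_lintegral_of_nonneg_ae (Eventually.of_forall fun y => abs_nonneg _) hmeas]
    simp_rw [← Real.norm_eq_abs, ofReal_norm]
  rw [h1, Lp.norm_def, mul_comm, ← ENNReal.toReal_mul]
  refine ENNReal.toReal_mono (ENNReal.mul_ne_top (Lp.eLpNorm_ne_top _) (by finiteness)) ?_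
  refine (eLpNorm_le_eLpNorm_mul_rpow_measure_univ (p := 1) (q := 2) (by norm_num)
    (Lp.aestronglyMeasurable _)).trans (le_of_eq ?_)
  norm_num

lemma denseRange_toL2 [R1Space Y] [NormalSpace Y] [WeaklyLocallyCompactSpace Y]
    [m.Regular] :
    DenseRange (toL2 m) := by
  intro u
  rw [Metric.mem_closure_iff]
  intro ε hε
  obtain ⟨g, hgc, hg, hgcont, hgm⟩ := (Lp.memLp u).exists_hasCompactSupport_eLpNorm_sub_le
    (by norm_num) (ε := ENNReal.ofReal (ε / 2)) (by simpa using hε)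
  let h : C_c(Y, ℝ) := ⟨⟨g, hgcont⟩, hgc⟩
  refine ⟨_, ⟨toZeroAtInfty h, rfl⟩, ?_⟩
  have hae : (toL2 m (toZeroAtInfty h) : Y → ℝ) =ᵐ[m] g := coeFn_toL2 m _
  rw [Lp.dist_def]
  calc (eLpNorm (u - toL2 m (toZeroAtInfty h) : Y → ℝ) 2 m).toReal
      = (eLpNorm (u - g : Y → ℝ) 2 m).toReal := by
        rw [eLpNorm_congr_ae ((ae_eq_refl _).sub hae)]
    _ ≤ ε / 2 := ENNReal.toReal_le_of_le_ofReal (by positivity) hg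
    _ < ε := by linarith

/-- A Lipschitz function fixing the origin acts on classes as it does on functions. -/
lemma toL2_eq_compLp {c : NNReal} {ψ : ℝ → ℝ} (hψ : LipschitzWith c ψ) (hψ0 : ψ 0 = 0)
    {f g : C₀(Y, ℝ)} (h : ∀ y, g y = ψ (f y)) : toL2 m g = hψ.compLp hψ0 (toL2 m f) := by
  refine Lp.ext ?_
  filter_upwards [coeFn_toL2 m g, hψ.coeFn_compLp hψ0 (toL2 m f), coeFn_toL2 m f] with y h1 h2 h3
  rw [h1, h2, Function.comp_apply, h3, h y]

end ToL2

/-! ### The functions of finite energy -/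

section QuadraticForm

variable {V : Type*} [AddCommGroup V] [Module ℝ V] {q : V → ℝ≥0∞}

lemma IsQuadraticForm.map_zero (hq : IsQuadraticForm q) : q 0 = 0 := by
  simpa using hq.map_smul 0 0

/-- The elements of finite energy. -/
def IsQuadraticForm.finiteEnergy (hq : IsQuadraticForm q) : Submodule ℝ V where
  carrier := {f | q f < ∞}
  zero_mem' := by simp [hq.map_zero]
  add_mem' {f g} hf hg := by
    have h : q (f + g) + q (f - g) < ∞ := by
      rw [hq.parallelogram]
      exact ENNReal.add_lt_top.2 ⟨ENNReal.mul_lt_top (by simp) hf, ENNReal.mul_lt_top (by simp) hg⟩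
    exact lt_of_le_of_lt le_self_add h
  smul_mem' c f hf := by
    change q (c • f) < ∞
    rw [hq.map_smul]
    exact ENNReal.mul_lt_top ENNReal.ofReal_lt_top hf

lemma IsQuadraticForm.mem_finiteEnergy (hq : IsQuadraticForm q) {f : V} :
    f ∈ hq.finiteEnergy ↔ q f < ∞ := Iff.rfl

lemma IsQuadraticForm.toReal_smul (hq : IsQuadraticForm q) (c : ℝ) (f : V) :
    (q (c • f)).toReal = c ^ 2 * (q f).toReal := by
  rw [hq.map_smul, ENNReal.toReal_mul, ENNReal.toReal_ofReal (sq_nonneg c)]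

lemma IsQuadraticForm.toReal_parallelogram (hq : IsQuadraticForm q) {f g : V}
    (hf : f ∈ hq.finiteEnergy) (hg : g ∈ hq.finiteEnergy) :
    (q (f + g)).toReal + (q (f - g)).toReal = 2 * (q f).toReal + 2 * (q g).toReal := by
  have hf' : q f ≠ ∞ := LT.lt.ne hf
  have hg' : q g ≠ ∞ := LT.lt.ne hg
  rw [← ENNReal.toReal_add (LT.lt.ne (Submodule.add_mem _ hf hg))
    (LT.lt.ne (Submodule.sub_mem _ hf hg)), hq.parallelogram,
    ENNReal.toReal_add (by finiteness) (by finiteness), ENNReal.toReal_mul, ENNReal.toReal_mul]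
  simp

lemma sqrt_toReal_le {V : Type*} [AddCommGroup V] {q : V → ℝ≥0∞}
    (htri : ∀ f g, q (f + g) ^ (1 / 2 : ℝ) ≤ q f ^ (1 / 2 : ℝ) + q g ^ (1 / 2 : ℝ))
    {f g : V} (hf : q f < ∞) (hg : q g < ∞) :
    √(q (f + g)).toReal ≤ √(q f).toReal + √(q g).toReal := by
  have hf' := hf.ne
  have hg' := hg.ne
  have h := ENNReal.toReal_mono (by finiteness) (htri f g)
  rw [ENNReal.toReal_add (by finiteness) (by finiteness)] at h
  simpa only [← ENNReal.toReal_rpow, ← Real.sqrt_eq_rpow] using h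

/-- If `fₙ → f` and the energies of the `fₙ` do not exceed that of `f`, then `fₙ → f` in energy:
by lower semicontinuity `q (f + fₙ)` is asymptotically at least `4 q f`, and the parallelogram
law turns this into an upper bound for `q (f - fₙ)`. -/
lemma IsQuadraticForm.tendsto_toReal_sub [TopologicalSpace V] [ContinuousAdd V]
    (hq : IsQuadraticForm q)
    (hlsc : ∀ (f : ℕ → V) (g : V), Tendsto f atTop (𝓝 g) → q g ≤ liminf (fun n => q (f n)) atTop)
    {f : V} (hf : f ∈ hq.finiteEnergy) {g : ℕ → V} (hg : Tendsto g atTop (𝓝 f))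
    (hle : ∀ n, q (g n) ≤ q f) : Tendsto (fun n => (q (f - g n)).toReal) atTop (𝓝 0) := by
  have hgD : ∀ n, g n ∈ hq.finiteEnergy := fun n => (hle n).trans_lt hf
  have hle' : ∀ n, (q (g n)).toReal ≤ (q f).toReal := fun n =>
    ENNReal.toReal_mono (LT.lt.ne hf) (hle n)
  have h2 : q (f + f) = ENNReal.ofReal (4 * (q f).toReal) := by
    rw [← two_smul ℝ f, hq.map_smul, ENNReal.ofReal_mul (by norm_num),
      ENNReal.ofReal_toReal (LT.lt.ne hf)]
    norm_num
  have hpar := fun n => hq.toReal_parallelogram hf (hgD n)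
  refine Metric.tendsto_atTop.2 fun ε hε => ?_
  suffices h : ∀ᶠ n in atTop, (q (f - g n)).toReal < ε by
    obtain ⟨N, hN⟩ := eventually_atTop.1 h
    refine ⟨N, fun n hn => ?_⟩
    rw [Real.dist_eq, sub_zero, abs_of_nonneg ENNReal.toReal_nonneg]
    exact hN n hn
  rcases (ENNReal.toReal_nonneg (a := q f)).eq_or_lt with h0 | hpos
  · refine Eventually.of_forall fun n => ?_
    linarith [hpar n, hle' n, ENNReal.toReal_nonneg (a := q (f + g n))]
  · have hlt : ENNReal.ofReal (4 * (q f).toReal - ε / 2) < liminf (fun n => q (f + g n)) atTop := by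
      refine lt_of_lt_of_le ?_ (hlsc _ _ (tendsto_const_nhds.add hg))
      rw [h2]
      exact (ENNReal.ofReal_lt_ofReal_iff (by positivity)).2 (by linarith)
    filter_upwards [eventually_lt_of_lt_liminf hlt] with n hn
    have h3 := (ENNReal.ofReal_le_iff_le_toReal (LT.lt.ne (Submodule.add_mem _ hf (hgD n)))).1
      hn.le
    linarith [hpar n, hle' n]

end QuadraticForm

/-! ### Lower semicontinuous forms on `C₀` extend to regular Dirichlet forms -/

section Extension

/-- Closability: if `q` is a supremum of squares of functionals `l k`, and if all `l k` tend to zero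
along a sequence that is Cauchy in energy, then the energy tends to zero. -/
lemma tendsto_of_cauchy_of_tendsto_functional {V : Type*} [AddCommGroup V] [Module ℝ V]
    {q : V → ℝ≥0∞} (hq : IsQuadraticForm q) {l : ℕ → V →ₗ[ℝ] ℝ}
    (hl : ∀ (t : ℝ) f, 0 < t → (q f ≤ ENNReal.ofReal (t ^ 2) ↔ ∀ n, |l n f| ≤ t))
    {f : ℕ → V} (hf : ∀ n, f n ∈ hq.finiteEnergy)
    (hcauchy : ∀ ε > 0, ∃ N, ∀ m ≥ N, ∀ n ≥ N, (q (f m - f n)).toReal < ε)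
    (hlim : ∀ k, Tendsto (fun n => l k (f n)) atTop (𝓝 0)) :
    Tendsto (fun n => (q (f n)).toReal) atTop (𝓝 0) := by
  refine Metric.tendsto_atTop.2 fun ε hε => ?_
  have ht : 0 < √(ε / 2) := Real.sqrt_pos.2 (by positivity)
  have ht2 : √(ε / 2) ^ 2 = ε / 2 := Real.sq_sqrt (by positivity)
  obtain ⟨N, hN⟩ := hcauchy (ε / 2) (by positivity)
  refine ⟨N, fun m hm => ?_⟩
  have key : q (f m) ≤ ENNReal.ofReal (√(ε / 2) ^ 2) := by
    refine (hl _ _ ht).2 fun k => ?_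
    have h1 : Tendsto (fun n => |l k (f m - f n)|) atTop (𝓝 |l k (f m)|) := by
      simpa using (tendsto_const_nhds.sub (hlim k)).abs
    refine le_of_tendsto h1 (eventually_atTop.2 ⟨N, fun n hn => ?_⟩)
    refine (hl _ _ ht).1 ?_ k
    rw [ht2]
    exact (ENNReal.le_ofReal_iff_toReal_le (LT.lt.ne (Submodule.sub_mem _ (hf m) (hf n)))
      (by positivity)).2 (hN m hm n hn).le
  rw [Real.dist_eq, sub_zero, abs_of_nonneg ENNReal.toReal_nonneg]
  have := ENNReal.toReal_le_of_le_ofReal (by positivity) key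
  rw [ht2] at this
  linarith

/-- The unit contraction `t ↦ (t ∧ 1) ∨ 0`. -/
def unitContraction (t : ℝ) : ℝ := max (min t 1) 0

lemma unitContraction_zero : unitContraction 0 = 0 := by simp [unitContraction]

lemma lipschitzWith_unitContraction : LipschitzWith 1 unitContraction :=
  (LipschitzWith.id.min_const 1).max_const 0

lemma polarization_of_bilinear {K : Type*} [AddCommGroup K] [Module ℝ K] (a : K →ₗ[ℝ] K →ₗ[ℝ] ℝ)
    (hsymm : ∀ u v, a u v = a v u) (u v : K) :
    a u v = (a (u + v) (u + v) - a (u - v) (u - v)) / 4 := by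
  simp only [map_add, map_sub, LinearMap.add_apply, LinearMap.sub_apply, hsymm v u]
  ring

lemma form_add_le {K : Type*} [SeminormedAddCommGroup K] [Module ℝ K] (a : K →ₗ[ℝ] K →ₗ[ℝ] ℝ)
    (hnonneg : ∀ u, 0 ≤ a u u) (u v : K) :
    a (u + v) (u + v) + ‖u + v‖ ^ 2 ≤ 2 * (a u u + ‖u‖ ^ 2) + 2 * (a v v + ‖v‖ ^ 2) := by
  have h := hnonneg (u - v)
  simp only [map_add, map_sub, LinearMap.add_apply, LinearMap.sub_apply] at h ⊢
  nlinarith [norm_add_le u v, norm_nonneg (u + v), sq_nonneg (‖u‖ - ‖v‖)]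

/-- If `u` is close to `j f` and `f` is close to `g`, then `u` is close to `j g`. -/
lemma form_sub_lt {L : Type*} [NormedAddCommGroup L] [InnerProductSpace ℝ L] {K : Submodule ℝ L}
    {a : K →ₗ[ℝ] K →ₗ[ℝ] ℝ} (hnonneg : ∀ u, 0 ≤ a u u) {V : Type*} [AddCommGroup V] [Module ℝ V]
    {j : V →ₗ[ℝ] K} {Q : V → ℝ} {J : V →ₗ[ℝ] L} (hJ : ∀ f, (j f : L) = J f)
    (hQ : ∀ f, a (j f) (j f) = Q f) {u : K} {f g : V} {ε : ℝ}
    (hf : a (u - j f) (u - j f) + ‖u - j f‖ ^ 2 < ε / 4)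
    (hg : Q (f - g) + ‖J (f - g)‖ ^ 2 < ε / 4) :
    a (u - j g) (u - j g) + ‖u - j g‖ ^ 2 < ε := by
  have h := form_add_le a hnonneg (u - j f) (j (f - g))
  rw [hQ, show ‖j (f - g)‖ = ‖J (f - g)‖ from congrArg norm (hJ (f - g)), map_sub,
    sub_add_sub_cancel] at h
  linarith

section UnitContraction

variable {Y : Type*} [TopologicalSpace Y]

/-- The unit contraction of a function vanishing at infinity. -/
def unitContractionComp (f : C₀(Y, ℝ)) : C₀(Y, ℝ) where
  toFun y := unitContraction (f y)
  continuous_toFun := lipschitzWith_unitContraction.continuous.comp f.continuous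
  zero_at_infty' := by
    have := (lipschitzWith_unitContraction.continuous.tendsto 0).comp f.zero_at_infty'
    rwa [unitContraction_zero] at this

end UnitContraction

/-- Functions of finite energy are approximated, in energy and in `L²`, by functions of finite
energy with compact support. -/
lemma exists_compactSupport_approx {Y : Type*} [TopologicalSpace Y] [MeasurableSpace Y]
    [BorelSpace Y] (m : Measure Y) [IsFiniteMeasure m] {q : C₀(Y, ℝ) → ℝ≥0∞}
    (hq : IsQuadraticForm q)
    (hlsc : ∀ (f : ℕ → C₀(Y, ℝ)) (g : C₀(Y, ℝ)), Tendsto f atTop (𝓝 g) →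
      q g ≤ liminf (fun n => q (f n)) atTop)
    (hcontr : ∀ ψ : ℝ → ℝ, ψ 0 = 0 → (∀ s t, |ψ s - ψ t| ≤ |s - t|) → ∀ f g : C₀(Y, ℝ),
      (∀ y, g y = ψ (f y)) → q g ≤ q f)
    {f : C₀(Y, ℝ)} (hf : f ∈ hq.finiteEnergy) {ε : ℝ} (hε : 0 < ε) :
    ∃ g : C_c(Y, ℝ), toZeroAtInfty g ∈ hq.finiteEnergy ∧
      (q (f - toZeroAtInfty g)).toReal + ‖toL2 m (f - toZeroAtInfty g)‖ ^ 2 < ε := by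
  have hgf : ∀ k : ℕ,
      q (toZeroAtInfty (softThresholdComp f (Nat.one_div_pos_of_nat (n := k)))) ≤ q f := fun k =>
    hcontr _ (softThreshold_zero Nat.one_div_pos_of_nat.le)
      (abs_softThreshold_sub_softThreshold_le _) _ _ fun y => rfl
  have hglim := tendsto_softThresholdComp f
  have hqlim := hq.tendsto_toReal_sub hlsc hf hglim hgf
  have hJlim := (((toL2 m).continuous.tendsto _).comp
    ((tendsto_const_nhds (x := f)).sub hglim)).norm.pow 2
  rw [sub_self, map_zero, norm_zero, zero_pow two_ne_zero] at hJlim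
  obtain ⟨k, hk⟩ := ((hqlim.add hJlim).eventually
    (gt_mem_nhds (show (0 : ℝ) + 0 < ε by linarith))).exists
  exact ⟨_, (hgf k).trans_lt hf, hk⟩

/-- If the functions of finite energy are uniformly dense in `C₀`, then those with compact support
are uniformly dense in `C_c`. -/
lemma exists_compactSupport_near {Y : Type*} [TopologicalSpace Y] {q : C₀(Y, ℝ) → ℝ≥0∞}
    (hq : IsQuadraticForm q) (hdense : Dense (hq.finiteEnergy : Set C₀(Y, ℝ)))
    (hcontr : ∀ ψ : ℝ → ℝ, ψ 0 = 0 → (∀ s t, |ψ s - ψ t| ≤ |s - t|) → ∀ f g : C₀(Y, ℝ),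
      (∀ y, g y = ψ (f y)) → q g ≤ q f)
    (h : C_c(Y, ℝ)) {ε : ℝ} (hε : 0 < ε) :
    ∃ g : C_c(Y, ℝ), toZeroAtInfty g ∈ hq.finiteEnergy ∧ ∀ y, |h y - g y| < ε := by
  obtain ⟨f, hf, hfh⟩ := Metric.dense_iff.1 hdense (toZeroAtInfty h) (ε / 2) (by positivity)
  have hε2 : 0 < ε / 2 := by positivity
  refine ⟨softThresholdComp f hε2, ?_, fun y => ?_⟩
  · exact (hcontr _ (softThreshold_zero hε2.le) (abs_softThreshold_sub_softThreshold_le _) f _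
      fun y => rfl).trans_lt hfh
  · have h1 := abs_apply_le_norm (f - toZeroAtInfty h) y
    rw [Metric.mem_ball, dist_eq_norm] at hf
    have h2 := abs_softThreshold_sub_le hε2.le (f y)
    have h3 : |f y - h y| < ε / 2 := h1.trans_lt hf
    rw [softThresholdComp_apply, abs_lt]
    rw [abs_lt] at h3
    rw [abs_le] at h2
    constructor <;> linarith [h2.1, h2.2, h3.1, h3.2]

variable {Y : Type*} [TopologicalSpace Y] [LocallyCompactSpace Y]
  [TopologicalSpace.MetrizableSpace Y] [SecondCountableTopology Y] [MeasurableSpace Y]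
  [BorelSpace Y] [Nonempty Y]

/-- A densely defined lower semicontinuous form on `C₀(Y, ℝ)` on which contractions operate is
closable in `L²` of a suitable finite measure of full support, its closure is a Dirichlet form, and
the functions of finite energy and compact support are a core. -/
theorem exists_dirichletForm_isCore [SecondCountableTopology C₀(Y, ℝ)] {q : C₀(Y, ℝ) → ℝ≥0∞}
    (hq : IsQuadraticForm q)
    (htri : ∀ f g, q (f + g) ^ (1 / 2 : ℝ) ≤ q f ^ (1 / 2 : ℝ) + q g ^ (1 / 2 : ℝ))
    (hlsc : ∀ (f : ℕ → C₀(Y, ℝ)) (g : C₀(Y, ℝ)), Tendsto f atTop (𝓝 g) →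
      q g ≤ liminf (fun n => q (f n)) atTop)
    (hdense : Dense (hq.finiteEnergy : Set C₀(Y, ℝ)))
    (hcontr : ∀ ψ : ℝ → ℝ, ψ 0 = 0 → (∀ s t, |ψ s - ψ t| ≤ |s - t|) → ∀ f g : C₀(Y, ℝ),
      (∀ y, g y = ψ (f y)) → q g ≤ q f) :
    ∃ m : Measure Y, IsFiniteMeasure m ∧ m.Regular ∧ m.IsOpenPosMeasure ∧
      ∃ 𝓔 : DirichletForm m,
        (∃ j : hq.finiteEnergy →ₗ[ℝ] 𝓔.domain,
          (∀ f, DirichletForm.IsClassOf (j f) f.1) ∧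
          (∀ f, 𝓔.form (j f) (j f) = (q f).toReal) ∧
          ∀ f g, 𝓔.form (j f) (j g) = polarization q f g) ∧
        𝓔.IsCore {h : C_c(Y, ℝ) | ∃ f ∈ hq.finiteEnergy, ∀ y, h y = f y} := by
  -- `√q = sup |l k|`, and `m` is chosen so that all `l k` are bounded for the norm of `L²(m)`
  obtain ⟨l, hl⟩ := exists_seq_functional hq.map_smul htri hlsc
  obtain ⟨m, hm, hpos, hlm⟩ := exists_measure_forall_abs_le l
  have hreg : m.Regular := inferInstance
  have hlJ : ∀ k, ∃ C : ℝ, ∀ f, |l k f| ≤ C * ‖toL2 m f‖ := fun k => by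
    obtain ⟨C, hC⟩ := hlm k
    refine ⟨|C| * (m Set.univ ^ (1 / 2 : ℝ)).toReal, fun f => (hC f).trans ?_⟩
    rw [mul_assoc]
    exact mul_le_mul (le_abs_self C) (integral_abs_le m f)
      (integral_nonneg fun y => abs_nonneg _) (abs_nonneg C)
  obtain ⟨K, a, j, hj, haj, hsymm, hnonneg, hcomplete, happrox, hweak⟩ :=
    exists_closure_of_closable (L := Lp ℝ 2 m) (fun f : hq.finiteEnergy => (q f).toReal)
      (fun f => ENNReal.toReal_nonneg) (fun c f => hq.toReal_smul c f)
      (fun f g => hq.toReal_parallelogram f.2 g.2) (fun f g => sqrt_toReal_le htri f.2 g.2)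
      ((toL2 m).toLinearMap ∘ₗ hq.finiteEnergy.subtype)
      ((toL2_injective m).comp Subtype.val_injective) (fun f hf hf0 => by
        refine tendsto_of_cauchy_of_tendsto_functional hq (l := fun n => (l n).toLinearMap) hl
          (fun n => (f n).2) hf fun k => ?_
        obtain ⟨C, hC⟩ := hlJ k
        have h0 : Tendsto (fun n => C * ‖toL2 m (f n)‖) atTop (𝓝 0) := by
          simpa using hf0.norm.const_mul C
        exact squeeze_zero_norm (fun n => hC (f n)) h0)
  have hjclass : ∀ f, ((j f : Lp ℝ 2 m) : Y → ℝ) =ᵐ[m] f.1 := fun f => by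
    rw [hj]
    exact coeFn_toL2 m f.1
  have hK : Dense (K : Set (Lp ℝ 2 m)) := by
    refine ((denseRange_toL2 m).dense_image (toL2 m).continuous hdense).mono ?_
    rintro _ ⟨f, hf, rfl⟩
    have := (j ⟨f, hf⟩).2
    rwa [hj] at this
  have hmarkov : ∀ u : K, ∃ v : K, ((v : Lp ℝ 2 m) : Y → ℝ) =ᵐ[m]
      (fun y => unitContraction (((u : Lp ℝ 2 m) : Y → ℝ) y)) ∧ a v v ≤ a u u := by
    intro u
    -- the contractions of approximants have bounded energy and converge in `L²`
    obtain ⟨f, -, hfu, hqu⟩ := happrox u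
    have hψ := lipschitzWith_unitContraction
    have hψ0 := unitContraction_zero
    have hgf : ∀ n, q (unitContractionComp (f n).1) ≤ q (f n) := fun n =>
      hcontr unitContraction hψ0 (fun s t => by simpa [Real.dist_eq] using hψ.dist_le_mul s t)
        _ _ fun y => rfl
    have hlim : Tendsto (fun n => toL2 m (unitContractionComp (f n).1)) atTop
        (𝓝 (hψ.compLp hψ0 (u : Lp ℝ 2 m))) := by
      refine (((LipschitzWith.continuous_compLp (p := 2) (μ := m) hψ hψ0).tendsto _).comp
        hfu).congr fun n => ?_
      exact (toL2_eq_compLp m hψ hψ0 (f := (f n).1) fun y => rfl).symm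
    obtain ⟨v, hv, hvu⟩ := hweak
      (fun n => ⟨unitContractionComp (f n).1, (hgf n).trans_lt (f n).2⟩) _ _ _ hlim
      hqu fun n => ENNReal.toReal_mono (LT.lt.ne (f n).2) (hgf n)
    refine ⟨v, ?_, hvu⟩
    rw [hv]
    exact hψ.coeFn_compLp hψ0 (u : Lp ℝ 2 m)
  have hcore : ∀ u : K, ∀ ε : ℝ, 0 < ε →
      ∃ h ∈ {h : C_c(Y, ℝ) | ∃ f ∈ hq.finiteEnergy, ∀ y, h y = f y},
      ∃ v : K, ((v : Lp ℝ 2 m) : Y → ℝ) =ᵐ[m] h ∧ a (u - v) (u - v) + ‖u - v‖ ^ 2 < ε := by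
    intro u ε hε
    obtain ⟨f, hfu, -, -⟩ := happrox u
    obtain ⟨n, hn⟩ := (hfu.eventually (gt_mem_nhds (show (0 : ℝ) < ε / 4 by positivity))).exists
    obtain ⟨g, hg, hgf⟩ := exists_compactSupport_approx m hq hlsc hcontr (f n).2
      (show 0 < ε / 4 by positivity)
    have h1 := form_sub_lt (f := f n) (g := ⟨toZeroAtInfty g, hg⟩) hnonneg hj haj hn hgf
    exact ⟨g, ⟨_, hg, fun y => rfl⟩, j ⟨_, hg⟩, hjclass _, h1⟩
  refine ⟨m, hm, hreg, hpos, ⟨K, a, hK, hsymm, hnonneg, hcomplete, hmarkov⟩,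
    ⟨j, hjclass, haj, fun f g => ?_⟩, ?_, hcore, fun h ε hε => ?_⟩
  · refine (polarization_of_bilinear a hsymm _ _).trans ?_
    rw [← map_add, ← map_sub, haj, haj]
    rfl
  · rintro h ⟨f, hf, hfh⟩
    exact ⟨j ⟨f, hf⟩, (hjclass ⟨f, hf⟩).trans (Eventually.of_forall fun y => (hfh y).symm)⟩
  · obtain ⟨g, hg, hgh⟩ := exists_compactSupport_near hq hdense hcontr h hε
    exact ⟨g, ⟨_, hg, fun y => rfl⟩, hgh⟩

end Extension

/-! ### Normal contractions -/

section Contractions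

lemma isNormalContraction_add : IsNormalContraction fun x : Fin 2 → ℝ => x 0 + x 1 := by
  refine ⟨by simp, fun x y => ?_⟩
  rw [Fin.sum_univ_two, add_sub_add_comm]
  exact abs_add_le _ _

lemma isNormalContraction_comp_apply {ψ : ℝ → ℝ} (h0 : ψ 0 = 0)
    (h : ∀ s t, |ψ s - ψ t| ≤ |s - t|) : IsNormalContraction fun x : Fin 1 → ℝ => ψ (x 0) :=
  ⟨h0, fun x y => by simpa using h (x 0) (y 0)⟩

/-- Truncation at the levels `±M`. -/
def truncation (M t : ℝ) : ℝ := max (min t M) (-M)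

lemma truncation_eq_self {M t : ℝ} (h : |t| ≤ M) : truncation M t = t := by
  rw [abs_le] at h
  rw [truncation, min_eq_left h.2, max_eq_left h.1]

lemma abs_truncation_le {M : ℝ} (hM : 0 ≤ M) (t : ℝ) : |truncation M t| ≤ M :=
  abs_le.2 ⟨le_max_right _ _, max_le (min_le_right _ _) (neg_le_self hM)⟩

lemma abs_truncation_sub_truncation_le (M s t : ℝ) :
    |truncation M s - truncation M t| ≤ |s - t| := by
  have h : LipschitzWith 1 (truncation M) := (LipschitzWith.id.min_const M).max_const (-M)
  simpa [Real.dist_eq] using h.dist_le_mul s t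

/-- On functions bounded by `M`, the product divided by `M` is a normal contraction. -/
lemma isNormalContraction_truncation_mul {M : ℝ} (hM : 0 < M) :
    IsNormalContraction fun x : Fin 2 → ℝ => M⁻¹ * (truncation M (x 0) * truncation M (x 1)) := by
  have h0 : truncation M 0 = 0 := truncation_eq_self (by simpa using hM.le)
  refine ⟨by simp [h0], fun x y => ?_⟩
  rw [Fin.sum_univ_two, ← mul_sub, abs_mul, abs_of_pos (inv_pos.2 hM), inv_mul_le_iff₀ hM,
    show truncation M (x 0) * truncation M (x 1) - truncation M (y 0) * truncation M (y 1)
      = (truncation M (x 0) - truncation M (y 0)) * truncation M (x 1)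
        + truncation M (y 0) * (truncation M (x 1) - truncation M (y 1)) by ring, mul_add]
  refine (abs_add_le _ _).trans (add_le_add ?_ ?_)
  · rw [abs_mul, mul_comm]
    exact mul_le_mul (abs_truncation_le hM.le _) (abs_truncation_sub_truncation_le _ _ _)
      (abs_nonneg _) hM.le
  · rw [abs_mul]
    exact mul_le_mul (abs_truncation_le hM.le _) (abs_truncation_sub_truncation_le _ _ _)
      (abs_nonneg _) hM.le

variable {X : Type*} [TopologicalSpace X] {A : NonUnitalSubalgebra ℝ (X →ᵇ ℝ)} {E : A → ℝ≥0∞}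

lemma NormalContractionsOperate.rpow_add_le (hE : NormalContractionsOperate E) (f g : A) :
    E (f + g) ^ (1 / 2 : ℝ) ≤ E f ^ (1 / 2 : ℝ) + E g ^ (1 / 2 : ℝ) := by
  simpa [Fin.sum_univ_two] using
    hE 2 _ isNormalContraction_add ![f, g] (f + g) fun x => by simp

lemma NormalContractionsOperate.le_of_comp (hE : NormalContractionsOperate E) {ψ : ℝ → ℝ}
    (h0 : ψ 0 = 0) (h : ∀ s t, |ψ s - ψ t| ≤ |s - t|) {f g : A}
    (hfg : ∀ x, (g : X →ᵇ ℝ) x = ψ ((f : X →ᵇ ℝ) x)) : E g ≤ E f := by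
  have := hE 1 _ (isNormalContraction_comp_apply h0 h) ![f] g fun x => by simpa using hfg x
  rw [Fin.sum_univ_one] at this
  exact (ENNReal.rpow_le_rpow_iff (by norm_num)).1 this

lemma NormalContractionsOperate.mul_lt_top (hE : NormalContractionsOperate E)
    (hq : IsQuadraticForm E) {f g : A} (hf : E f < ∞) (hg : E g < ∞) : E (f * g) < ∞ := by
  obtain ⟨M, hM, hfM, hgM⟩ : ∃ M : ℝ, 0 < M ∧ ‖(f : X →ᵇ ℝ)‖ ≤ M ∧ ‖(g : X →ᵇ ℝ)‖ ≤ M :=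
    ⟨max ‖(f : X →ᵇ ℝ)‖ ‖(g : X →ᵇ ℝ)‖ + 1, by positivity,
      (le_max_left _ _).trans (by linarith), (le_max_right _ _).trans (by linarith)⟩
  have h := hE 2 _ (isNormalContraction_truncation_mul hM) ![f, g] (M⁻¹ • (f * g)) fun x => by
    simp [truncation_eq_self (((f : X →ᵇ ℝ).norm_coe_le_norm x).trans hfM),
      truncation_eq_self (((g : X →ᵇ ℝ).norm_coe_le_norm x).trans hgM)]
  have hlt : E (M⁻¹ • (f * g)) < ∞ := by
    have hsum : ∑ i, E (![f, g] i) ^ (1 / 2 : ℝ) < ∞ := by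
      rw [Fin.sum_univ_two]
      have := hf.ne
      have := hg.ne
      change E f ^ (1 / 2 : ℝ) + E g ^ (1 / 2 : ℝ) < ∞
      finiteness
    exact (ENNReal.rpow_lt_top_iff_of_pos (by norm_num)).1 (h.trans_lt hsum)
  have h2 := hq.map_smul M (M⁻¹ • (f * g))
  rw [smul_smul, mul_inv_cancel₀ hM.ne', one_smul] at h2
  rw [h2]
  exact ENNReal.mul_lt_top ENNReal.ofReal_lt_top hlt

/-- The algebra of functions of finite energy. -/
def finiteEnergyAlgebra (hq : IsQuadraticForm E) (hE : NormalContractionsOperate E) :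
    NonUnitalSubalgebra ℝ A where
  carrier := {f | E f < ∞}
  zero_mem' := hq.finiteEnergy.zero_mem
  add_mem' := hq.finiteEnergy.add_mem
  smul_mem' c _ := hq.finiteEnergy.smul_mem c
  mul_mem' := hE.mul_lt_top hq

end Contractions

end SupNormForm

end

theorem theorem1p1 {X : Type*} [Nonempty X] [TopologicalSpace X] [DiscreteTopology X]
    (A : NonUnitalSubalgebra ℝ (X →ᵇ ℝ))
    (hA_closed : IsClosed (A : Set (X →ᵇ ℝ)))
    (hA_gen : SupNormForm.CountablyGenerated A)
    (hA_sep : SupNormForm.SeparatesPoints A)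
    (E : A → ℝ≥0∞)
    (hE_quad : SupNormForm.IsQuadraticForm E)
    (hE_sep : SupNormForm.SupNormSeparable E)
    (hE_fin : SupNormForm.SigmaFiniteForm E)
    (hE_lsc : SupNormForm.SupNormLSC E)
    (hE_contr : SupNormForm.NormalContractionsOperate E) :
    -- the spectrum is a locally compact separable metrizable space
    LocallyCompactSpace (SupNormForm.Spectrum A) ∧
    TopologicalSpace.SeparableSpace (SupNormForm.Spectrum A) ∧
    TopologicalSpace.MetrizableSpace (SupNormForm.Spectrum A) ∧
    -- the effective domain `D` is an algebra
    ∃ D : NonUnitalSubalgebra ℝ A, (D : Set A) = {f | E f < ∞} ∧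
    -- the Gelfand transform is an algebra homomorphism on `D`, isometric (hence injective) for
    -- the sup-norms, into the real continuous functions (which even vanish at infinity)
    ∃ T : D →ₙₐ[ℝ] C₀(SupNormForm.Spectrum A, ℝ),
      (∀ (f : D) (φ : SupNormForm.Spectrum A),
        ((T f φ : ℝ) : ℂ) = SupNormForm.gelfand (f : A) φ) ∧
      (∀ f : D, ‖T f‖ = ‖((f : A) : X →ᵇ ℝ)‖) ∧
    -- the transferred form extends to a regular Dirichlet form
    ∃ m : Measure (SupNormForm.Spectrum A),
      IsFiniteMeasure m ∧ m.Regular ∧ m.IsOpenPosMeasure ∧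
      ∃ 𝓔 : SupNormForm.DirichletForm m, 𝓔.IsRegular ∧
        (∃ j : D →ₗ[ℝ] 𝓔.domain,
          (∀ f : D, SupNormForm.DirichletForm.IsClassOf (j f) (T f)) ∧
          (∀ f : D, 𝓔.form (j f) (j f) = (E (f : A)).toReal) ∧
          ∀ f g : D, 𝓔.form (j f) (j g) = SupNormForm.polarization E (f : A) (g : A)) ∧
        -- the compactly supported transforms form a core
        𝓔.IsCore {h : C_c(SupNormForm.Spectrum A, ℝ) | ∃ f : D, ∀ φ, h φ = T f φ} := by
  open SupNormForm in
  have hne : ∀ x, ∃ f : A, (f : X →ᵇ ℝ) x ≠ 0 := fun x => by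
    obtain ⟨χ, hχ, -⟩ := hE_fin
    exact ⟨χ, (hχ x).ne'⟩
  have hsepA : TopologicalSpace.SeparableSpace A := hA_gen.separableSpace
  have hmetr : TopologicalSpace.MetrizableSpace (Spectrum A) := metrizableSpace_spectrum
  have hsc : SecondCountableTopology (Spectrum A) := secondCountableTopology_spectrum
  have hnonempty : Nonempty (Spectrum A) := ⟨evalCharacter (Classical.arbitrary X) (hne _)⟩
  have hiso := isometry_gelfandHom hne
  have hsurj := surjective_gelfandHom hA_closed hne
  have hscC : SecondCountableTopology C₀(Spectrum A, ℝ) := by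
    have : TopologicalSpace.SeparableSpace C₀(Spectrum A, ℝ) :=
      hsurj.denseRange.separableSpace hiso.continuous
    exact UniformSpace.secondCountable_of_separable _
  let e : A ≃ₗ[ℝ] C₀(Spectrum A, ℝ) := gelfandEquiv hA_closed hne
  have he : ∀ f, e f = gelfandHom A f := fun f => rfl
  have heval : ∀ (f : C₀(Spectrum A, ℝ)) x,
      ((e.symm f : A) : X →ᵇ ℝ) x = f (evalCharacter x (hne x)) := fun f x => by
    rw [← gelfandHom_evalCharacter (e.symm f) x (hne x), ← he, e.apply_symm_apply]
  -- the form transported to `C₀` of the spectrum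
  let q : C₀(Spectrum A, ℝ) → ℝ≥0∞ := fun f => E (e.symm f)
  have hqe : ∀ f, q (gelfandHom A f) = E f := fun f => by
    change E (e.symm (e f)) = E f
    rw [e.symm_apply_apply]
  have hq : IsQuadraticForm q :=
    ⟨fun c f => by simp only [q, map_smul, hE_quad.map_smul], fun f g => by
      simp only [q, map_add, map_sub, hE_quad.parallelogram]⟩
  let D := finiteEnergyAlgebra hE_quad hE_contr
  have hD : ∀ f : D, gelfandHom A f ∈ hq.finiteEnergy := fun f => by
    rw [hq.mem_finiteEnergy, hqe]
    exact f.2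
  have hdense : Dense (hq.finiteEnergy : Set C₀(Spectrum A, ℝ)) := by
    obtain ⟨f, hf, hfE⟩ := hE_sep
    have hle : NonUnitalAlgebra.adjoin ℝ (Set.range f) ≤ D :=
      NonUnitalAlgebra.adjoin_le (by rintro _ ⟨n, rfl⟩; exact hfE n)
    have hDdense : Dense (D : Set A) := Dense.mono hle hf
    refine (hsurj.denseRange.dense_image hiso.continuous hDdense).mono ?_
    rintro _ ⟨g, hg, rfl⟩
    exact hD ⟨g, hg⟩
  obtain ⟨m, hm, hreg, hpos, 𝓔, ⟨j, hj, hj1, hj2⟩, hcore⟩ := exists_dirichletForm_isCore hq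
    (fun f g => by simpa only [q, map_add] using hE_contr.rpow_add_le _ _)
    (fun f g hfg => hE_lsc _ _ (by
      have hinv : Isometry e.symm := Isometry.right_inv (f := e) hiso e.apply_symm_apply
      exact (hinv.continuous.tendsto g).comp hfg))
    hdense
    (fun ψ h0 h f g hfg => hE_contr.le_of_comp h0 h fun x => by rw [heval, heval, hfg])
  have hset : {h : C_c(Spectrum A, ℝ) | ∃ f ∈ hq.finiteEnergy, ∀ y, h y = f y}
      = {h : C_c(Spectrum A, ℝ) | ∃ f : D, ∀ φ, h φ = gelfandHom A f φ} := by
    ext h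
    constructor
    · rintro ⟨f, hf, hfh⟩
      refine ⟨⟨e.symm f, hf⟩, fun φ => (hfh φ).trans ?_⟩
      rw [← he, e.apply_symm_apply]
    · rintro ⟨f, hf⟩
      exact ⟨_, hD f, hf⟩
  rw [hset] at hcore
  refine ⟨inferInstance, inferInstance, hmetr, D, rfl,
    (gelfandHom A).comp (NonUnitalSubalgebraClass.subtype D), fun f φ => coe_gelfandHom_apply f.1 φ,
    fun f => norm_gelfandHom hne f.1, m, hm, hreg, hpos, 𝓔,
    ⟨inferInstance, inferInstance, hmetr, hreg, hpos, _, hcore⟩,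
    ⟨j ∘ₗ LinearMap.codRestrict hq.finiteEnergy
      ((gelfandHom A : A →ₗ[ℝ] C₀(Spectrum A, ℝ)) ∘ₗ D.toSubmodule.subtype) hD,
      fun f => hj _, fun f => (hj1 _).trans (congrArg ENNReal.toReal (hqe f.1)), fun f g => ?_⟩,
    hcore⟩
  refine (hj2 _ _).trans ?_
  change ((q (gelfandHom A f + gelfandHom A g)).toReal
    - (q (gelfandHom A f - gelfandHom A g)).toReal) / 4 = _
  rw [← map_add, ← map_sub, hqe, hqe]
  rfl
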